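/- Let $n\ge 1$. Let $\mathcal P$ be the family of Gaussian distributions $p=\mathrm{normal}(\mu,\Sigma)$ on $\mathbb R^n$ with $\Sigma$ positive definite and not diagonal, and let $\mathcal Q$ be the family of Gaussians $q=\mathrm{normal}(\nu,\Psi)$ on $\mathbb R^n$ with $\Psi$ diagonal and $0<\Psi_{ii}<\infty$ for all $i$. Writing $p,q$ also for the densities and $\|v\|_A^2=v^\top A v$, consider the divergences $$\mathrm{KL}(q\|p)=\mathbb E_q\Big[\log\frac qp\Big],\qquad \mathrm{KL}(p\|q)=\mathbb E_p\Big[\log\frac pq\Big],\qquad R_\alpha(p\|q)=\frac1{\alpha(\alpha-1)}\,\mathbb E_q\Big[\frac{p^\alpha}{q^\alpha}-1\Big]\quad(0<\alpha<1),$$ $$S(q\|p)=\mathbb E_q\Big[\big\|\nabla\log\tfrac qp\big\|^2_{\mathrm{Cov}(q)}\Big],\qquad S(p\|q)=\mathbb E_p\Big[\big\|\nabla\log\tfrac qp\big\|^2_{\mathrm{Cov}(p)}\Big].$$ For such a divergence $D$ and $p\in\mathcal P$, call $(\Psi_{11},\dots,\Psi_{nn})\in[0,\infty]^n$ optimal for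 $D$ at $p$ if it is the limit of the marginal variances of a sequence $q_k\in\mathcal Q$ with $D(q_k,p)\to\inf_{q\in\mathcal Q}D(q,p)$. (The variances of any minimizer of $D(\cdot,p)$ in $\mathcal Q$ are optimal; the values $0$ and $\infty$ allow for score-based divergences whose infimum is not attained in $\mathcal Q$.) Write $D_b\prec D_a$ if for every $p\in\mathcal P$ the optimal variances $\Psi^a$ of $D_a$ and $\Psi^b$ of $D_b$ at $p$ exist and are unique, $\Psi^b_{ii}\le\Psi^a_{ii}$ for all $i$, and $\Psi^b_{ii}<\Psi^a_{ii}$ for at least one $i$. Then, for all $0<\alpha_1<\alpha_2<1$, $$S(q\|p)\prec \mathrm{KL}(q\|p)\prec R_{\alpha_1}(p\|q)\prec R_{\alpha_2}(p\|q)\prec \mathrm{KL}(p\|q)\prec S(p\|q).$$ Moreover, for every $p\in\mathcal P$ and $\alpha\in(0,1)$, the divergence $R_\alpha(p\|q)$ attains its minimum over $q\in\mathcal Q$, at some $q$ whose marginal variances $\Psi_{ii}(\alpha)\in(0,\infty)$ are the unique optimal ones, and for each $i$ with $\Sigma_{ii}(\Sigma^{-1})_{ii}>1$ the function $\alpha\mapsto\Psi_{ii}(\alpha)$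 is strictly increasing on $(0,1)$. -/

import Mathlib

open MeasureTheory Filter Topology
open scoped ENNReal Matrix

noncomputable section

namespace FGVI

/-- Euclidean space `ℝⁿ`. -/
abbrev E (n : ℕ) := EuclideanSpace ℝ (Fin n)

/-- The Lebesgue density of `normal(m, C)`, for a positive definite covariance matrix `C`. -/
def gaussianDensity {n : ℕ} (m : E n) (C : Matrix (Fin n) (Fin n) ℝ) (z : E n) : ℝ :=
  (Real.sqrt ((2 * Real.pi) ^ n * C.det))⁻¹ *
    Real.exp (-(1 / 2) * ((z - m).ofLp ⬝ᵥ (C⁻¹ *ᵥ (z - m).ofLp)))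

/-- The density of the factorized Gaussian with mean `ν` and marginal variances `ψ`. -/
def factorizedDensity {n : ℕ} (ν : E n) (ψ : Fin n → ℝ) : E n → ℝ :=
  gaussianDensity ν (Matrix.diagonal ψ)

/-- The variational family `𝒬` of factorized Gaussians (proper distributions: all marginal
variances are positive and finite). -/
def factorizedFamily (n : ℕ) : Set (E n → ℝ) :=
  {q | ∃ (ν : E n) (ψ : Fin n → ℝ), (∀ i, 0 < ψ i) ∧ q = factorizedDensity ν ψ}

/-- The expectation `𝔼_q[f]` under the density `q`. -/
def expect {n : ℕ} (q f : E n → ℝ) : ℝ := ∫ z, q z * f z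

/-- The covariance matrix of the density `q`. -/
def cov {n : ℕ} (q : E n → ℝ) : Matrix (Fin n) (Fin n) ℝ := fun i j =>
  expect q (fun z => (z i - expect q (fun w => w i)) * (z j - expect q (fun w => w j)))

/-- The squared weighted norm `‖v‖²_A = vᵀ A v`. -/
def weightedNormSq {n : ℕ} (A : Matrix (Fin n) (Fin n) ℝ) (v : E n) : ℝ :=
  v.ofLp ⬝ᵥ (A *ᵥ v.ofLp)

/-- A divergence `D(q, p)` as a functional of the densities; the first argument is always the
approximation `q` and the second one the target `p`. -/
abbrev Divergence (n : ℕ) := (E n → ℝ) → (E n → ℝ) → ℝ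

/-- `KL(q||p) = 𝔼_q[log (q/p)]`. -/
def klReverse (n : ℕ) : Divergence n := fun q p =>
  expect q (fun z => Real.log (q z / p z))

/-- `KL(p||q) = 𝔼_p[log (p/q)]`. -/
def klForward (n : ℕ) : Divergence n := fun q p =>
  expect p (fun z => Real.log (p z / q z))

/-- `R_α(p||q) = 1/(α(α-1)) 𝔼_q[p^α/q^α - 1]`. -/
def renyi (n : ℕ) (α : ℝ) : Divergence n := fun q p =>
  1 / (α * (α - 1)) * expect q (fun z => p z ^ α / q z ^ α - 1)

/-- `S(q||p) = 𝔼_q[‖∇ log (q/p)‖²_Cov(q)]`. -/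
def scoreReverse (n : ℕ) : Divergence n := fun q p =>
  expect q (fun z => weightedNormSq (cov q) (gradient (fun w => Real.log (q w / p w)) z))

/-- `S(p||q) = 𝔼_p[‖∇ log (q/p)‖²_Cov(p)]`. -/
def scoreForward (n : ℕ) : Divergence n := fun q p =>
  expect p (fun z => weightedNormSq (cov p) (gradient (fun w => Real.log (q w / p w)) z))

/-- The factorized Gaussian with mean `ν` and marginal variances `ψ` lies in `𝒬` and minimizes
`q ↦ D(q, p)` over `𝒬`. -/
def IsMinimizer {n : ℕ} (D : Divergence n) (p : E n → ℝ) (ν : E n) (ψ : Fin n → ℝ) : Prop :=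
  (∀ i, 0 < ψ i) ∧ ∀ q ∈ factorizedFamily n, D (factorizedDensity ν ψ) p ≤ D q p

/-- `v` is a vector of marginal variances in `[0, ∞]` obtained by minimizing `q ↦ D(q, p)` over
`𝒬`: it is the limit of the marginal variances along a minimizing sequence. A constant sequence
shows that the variances of every minimizer in `𝒬` are of this kind; the values `0` and `∞` occur
when the infimum is only approached as some variances collapse or blow up. -/
def IsOptimalVariances {n : ℕ} (D : Divergence n) (p : E n → ℝ) (v : Fin n → ℝ≥0∞) : Prop :=
  ∃ (ν : ℕ → E n) (ψ : ℕ → Fin n → ℝ) (L : ℝ),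
    (∀ k i, 0 < ψ k i) ∧
    IsGLB ((fun q => D q p) '' factorizedFamily n) L ∧
    Tendsto (fun k => D (factorizedDensity (ν k) (ψ k)) p) atTop (𝓝 L) ∧
    ∀ i, Tendsto (fun k => ENNReal.ofReal (ψ k i)) atTop (𝓝 (v i))

/-- `Da ≻ Db`: for every Gaussian target with non-diagonal covariance, each of the two divergences
determines its vector of optimal marginal variances uniquely, and those of `Da` are at least as
large as those of `Db` in every coordinate and strictly larger in some coordinate. -/
def Dominates {n : ℕ} (Da Db : Divergence n) : Prop :=
  ∀ (μ : E n) (C : Matrix (Fin n) (Fin n) ℝ), C.PosDef → ¬ C.IsDiag →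
    ∃ va vb : Fin n → ℝ≥0∞,
      (∀ v, IsOptimalVariances Da (gaussianDensity μ C) v ↔ v = va) ∧
      (∀ v, IsOptimalVariances Db (gaussianDensity μ C) v ↔ v = vb) ∧
      (∀ i, vb i ≤ va i) ∧ ∃ i, vb i < va i

end FGVI

end

/-!
Minimizing over the mean reduces each divergence to a function of the marginal variances `ψ` alone,
its profile. With `Λ = C⁻¹`, the Kullback-Leibler profiles decouple into one-dimensional problems
with solutions `ψ i = 1 / Λ i i` (reverse) and `ψ i = C i i` (forward). The score-based profiles are
convex quadratic functions of `s = ψ` (with `A = Λ`) or of `s = 1 / ψ` (with `A = C`); their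
optimality conditions on the closed orthant give `∑ j, A i j ^ 2 * s j = A i i` if `0 < s i`, hence
`s i ≤ 1 / A i i`.

For `R_α`, put `M α ψ = α • diagonal ψ + (1 - α) • C`; a minimizer satisfies
`(M α ψ)⁻¹ i i = (ψ i)⁻¹`. The map `α ↦ (M α ψ)⁻¹ i i` is convex on `[0, 1]` with value `(ψ i)⁻¹`
at `1`, so a stationary point for `α` satisfies `(M β ψ)⁻¹ i i ≤ (ψ i)⁻¹` for `α < β < 1`. A vector
with this property lies below the stationary point for `β`: scale the latter until it touches the
former from above and use that matrix inversion is antitone.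
-/

namespace FGVI

section GaussianMeasure

open ProbabilityTheory

section Standard

variable {F : Type*} [NormedAddCommGroup F] [InnerProductSpace ℝ F] [FiniteDimensional ℝ F]
  [MeasurableSpace F] [BorelSpace F]

lemma integrable_exp_neg_half_mul_norm_sq :
    Integrable fun z : F => Real.exp (-(1 / 2) * ‖z‖ ^ 2) := by
  have h := GaussianFourier.integrable_cexp_neg_mul_sq_norm_add (b := 1 / 2) (by norm_num) 0 (0 : F)
  refine h.norm.congr (ae_of_all _ fun z => ?_)
  simp only [Complex.norm_exp]
  norm_num [← Complex.ofReal_pow]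

lemma integral_exp_neg_half_mul_norm_sq_mul_cexp_inner (t : F) :
    ∫ z : F, (Real.exp (-(1 / 2) * ‖z‖ ^ 2) : ℂ) * Complex.exp (inner ℝ z t * Complex.I) =
      √((2 * Real.pi) ^ Module.finrank ℝ F) * Complex.exp (-(‖t‖ ^ 2 / 2)) := by
  have h := GaussianFourier.integral_cexp_neg_mul_sq_norm_add (b := 1 / 2) (by norm_num) Complex.I t
  have hconst : ((Real.pi / (1 / 2) : ℂ) ^ ((Module.finrank ℝ F : ℂ) / 2)) =
      √((2 * Real.pi) ^ Module.finrank ℝ F) := by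
    rw [Real.sqrt_eq_rpow, ← Real.rpow_natCast, ← Real.rpow_mul (by positivity),
      Complex.ofReal_cpow (by positivity)]
    push_cast
    ring_nf
  rw [hconst, Complex.I_sq] at h
  convert! h using 2
  · ext z
    rw [← real_inner_comm, mul_comm _ Complex.I, Complex.exp_add]
    push_cast
    rfl
  · ring_nf

lemma stdGaussian_eq_withDensity :
    stdGaussian F = volume.withDensity fun z => ENNReal.ofReal
      ((√((2 * Real.pi) ^ Module.finrank ℝ F))⁻¹ * Real.exp (-(1 / 2) * ‖z‖ ^ 2)) := by
  set c := √((2 * Real.pi) ^ Module.finrank ℝ F)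
  have hc : 0 < c := by positivity
  have := isFiniteMeasure_withDensity_ofReal
    ((integrable_exp_neg_half_mul_norm_sq (F := F)).const_mul c⁻¹).2
  refine Measure.ext_of_charFun (funext fun t => ?_)
  rw [charFun_stdGaussian, charFun_apply, integral_withDensity_eq_integral_toReal_smul (by fun_prop)
    (ae_of_all _ fun _ => ENNReal.ofReal_lt_top)]
  have hpt (z : F) : (ENNReal.ofReal (c⁻¹ * Real.exp (-(1 / 2) * ‖z‖ ^ 2))).toReal •
      Complex.exp (inner ℝ z t * Complex.I) = (c⁻¹ : ℂ) *
        ((Real.exp (-(1 / 2) * ‖z‖ ^ 2) : ℂ) * Complex.exp (inner ℝ z t * Complex.I)) := by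
    rw [ENNReal.toReal_ofReal (by positivity), Complex.real_smul, Complex.ofReal_mul, mul_assoc,
      Complex.ofReal_inv]
  simp_rw [hpt]
  rw [integral_const_mul, integral_exp_neg_half_mul_norm_sq_mul_cexp_inner,
    inv_mul_cancel_left₀ (Complex.ofReal_ne_zero.2 hc.ne')]
  ring_nf

end Standard

lemma lintegral_comp_add_linearMap {F : Type*} [NormedAddCommGroup F] [InnerProductSpace ℝ F]
    [FiniteDimensional ℝ F] [MeasurableSpace F] [BorelSpace F] (m : F) {T : F →ₗ[ℝ] F}
    (hT : LinearMap.det T ≠ 0) {f : F → ℝ≥0∞} (hf : Measurable f) :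
    ENNReal.ofReal |LinearMap.det T| * ∫⁻ w, f (m + T w) = ∫⁻ z, f z := by
  have hTm : Measurable T := T.continuous_of_finiteDimensional.measurable
  rw [← lintegral_map (f := fun z => f (m + z)) (by fun_prop) hTm,
    Measure.map_linearMap_addHaar_eq_smul_addHaar _ hT, lintegral_smul_measure,
    lintegral_add_left_eq_self f m, smul_eq_mul, ← mul_assoc, ← ENNReal.ofReal_mul (abs_nonneg _),
    ← abs_mul, mul_inv_cancel₀ hT]
  simp only [abs_one, ENNReal.ofReal_one, one_mul]

variable {n : ℕ}

lemma continuous_gaussianDensity (m : E n) (C : Matrix (Fin n) (Fin n) ℝ) :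
    Continuous (gaussianDensity m C) := by
  unfold gaussianDensity Matrix.mulVec dotProduct
  fun_prop

lemma gaussianDensity_pos (m : E n) {C : Matrix (Fin n) (Fin n) ℝ} (hC : C.PosDef) (z : E n) :
    0 < gaussianDensity m C z := by
  have := hC.det_pos
  unfold gaussianDensity
  positivity

lemma abs_det_mul_gaussianDensity_add (m w : E n) {R : Matrix (Fin n) (Fin n) ℝ}
    (hR : R.det ≠ 0) :
    |R.det| * gaussianDensity m (R * Rᵀ) (m + Matrix.toEuclideanLin R w) =
      (√((2 * Real.pi) ^ n))⁻¹ * Real.exp (-(1 / 2) * ‖w‖ ^ 2) := by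
  have hunit : IsUnit R.det := hR.isUnit
  have hquad : (R *ᵥ w.ofLp) ⬝ᵥ ((R * Rᵀ)⁻¹ *ᵥ (R *ᵥ w.ofLp)) = ‖w‖ ^ 2 := by
    rw [Matrix.mul_inv_rev, ← Matrix.mulVec_mulVec, Matrix.mulVec_mulVec _ R⁻¹ R,
      Matrix.nonsing_inv_mul _ hunit, Matrix.one_mulVec, ← Matrix.transpose_nonsing_inv,
      Matrix.mulVec_transpose, dotProduct_comm, ← Matrix.dotProduct_mulVec, Matrix.mulVec_mulVec,
      Matrix.nonsing_inv_mul _ hunit, Matrix.one_mulVec, EuclideanSpace.real_norm_sq_eq]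
    simp only [dotProduct, sq]
  have hofLp : (m + Matrix.toEuclideanLin R w - m).ofLp = R *ᵥ w.ofLp := by
    rw [add_sub_cancel_left]
    rfl
  rw [gaussianDensity, hofLp, hquad, Matrix.det_mul, Matrix.det_transpose,
    Real.sqrt_mul (by positivity), Real.sqrt_mul_self_eq_abs, mul_inv]
  have := abs_pos.2 hR
  field_simp

open MatrixOrder in
lemma multivariateGaussian_eq_withDensity (m : E n) {C : Matrix (Fin n) (Fin n) ℝ}
    (hC : C.PosDef) :
    multivariateGaussian m C =
      volume.withDensity fun z => ENNReal.ofReal (gaussianDensity m C z) := by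
  set R := CFC.sqrt C
  have hRsymm : Rᵀ = R := by
    simpa [IsSelfAdjoint, Matrix.star_eq_conjTranspose] using (CFC.sqrt_nonneg C).isSelfAdjoint
  have hRR : R * Rᵀ = C := by rw [hRsymm, CFC.sqrt_mul_sqrt_self _ hC.posSemidef.nonneg]
  have hRdet : R.det ≠ 0 := fun h => hC.det_pos.ne' (by rw [← hRR, Matrix.det_mul, h, zero_mul])
  set T := Matrix.toEuclideanLin R with hT
  have hTdet : LinearMap.det T = R.det := by
    rw [hT, Matrix.toEuclideanLin, Matrix.toLpLin_eq_toLin, LinearMap.det_toLin]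
  have hTm : Measurable fun w => m + T w :=
    T.continuous_of_finiteDimensional.measurable.const_add m
  have hdm := (continuous_gaussianDensity m C).measurable.ennreal_ofReal
  have hdensity (w : E n) : ENNReal.ofReal ((√((2 * Real.pi) ^ Module.finrank ℝ (E n)))⁻¹ *
      Real.exp (-(1 / 2) * ‖w‖ ^ 2)) =
        ENNReal.ofReal |R.det| * ENNReal.ofReal (gaussianDensity m C (m + T w)) := by
    rw [finrank_euclideanSpace_fin, ← abs_det_mul_gaussianDensity_add m w hRdet, hRR,
      ENNReal.ofReal_mul (abs_nonneg _)]
  refine Measure.ext_of_lintegral _ fun f hf => ?_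
  change ∫⁻ z, f z ∂(stdGaussian (E n)).map (fun w => m + T w) = _
  have hfT : Measurable fun w => f (m + T w) := hf.comp hTm
  rw [lintegral_map hf hTm, stdGaussian_eq_withDensity,
    lintegral_withDensity_eq_lintegral_mul _ (by fun_prop) hfT,
    lintegral_withDensity_eq_lintegral_mul _ hdm hf]
  simp only [Pi.mul_apply, hdensity, mul_assoc]
  rw [lintegral_const_mul' _ _ ENNReal.ofReal_ne_top, ← hTdet]
  exact lintegral_comp_add_linearMap m (hTdet ▸ hRdet) (hdm.mul hf)

end GaussianMeasure

section Moments

open ProbabilityTheory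

variable {n : ℕ} (m : E n) {C : Matrix (Fin n) (Fin n) ℝ}

lemma expect_gaussianDensity (hC : C.PosDef) (f : E n → ℝ) :
    expect (gaussianDensity m C) f = ∫ z, f z ∂(multivariateGaussian m C) := by
  rw [multivariateGaussian_eq_withDensity m hC, integral_withDensity_eq_integral_toReal_smul
    (continuous_gaussianDensity m C).measurable.ennreal_ofReal
    (ae_of_all _ fun _ => ENNReal.ofReal_lt_top)]
  simp only [expect, ENNReal.toReal_ofReal (gaussianDensity_pos m hC _).le, smul_eq_mul]

lemma integral_gaussianDensity (hC : C.PosDef) : ∫ z, gaussianDensity m C z = 1 := by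
  simpa [expect] using expect_gaussianDensity m hC fun _ => 1

variable (C) in
lemma memLp_apply_sub_multivariateGaussian (c : E n) (i : Fin n) :
    MemLp (fun z : E n => z i - c i) 2 (multivariateGaussian m C) :=
  ((EuclideanSpace.proj (𝕜 := ℝ) i).comp_memLp' IsGaussian.memLp_two_id).sub (memLp_const (c i))

variable (C) in
lemma integral_apply_multivariateGaussian (i : Fin n) :
    ∫ z : E n, z i ∂(multivariateGaussian m C) = m i := by
  simpa using (EuclideanSpace.proj (𝕜 := ℝ) i).integral_comp_comm
    (IsGaussian.integrable_id (μ := multivariateGaussian m C))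

lemma integral_apply_sub_mul_apply_sub_multivariateGaussian (hC : C.PosSemidef) (c d : E n)
    (i j : Fin n) :
    ∫ z : E n, (z i - c i) * (z j - d j) ∂(multivariateGaussian m C) =
      C i j + (m i - c i) * (m j - d j) := by
  have hint (c : E n) (i : Fin n) : Integrable (fun z : E n => z i - c i)
      (multivariateGaussian m C) :=
    (memLp_apply_sub_multivariateGaussian m C c i).integrable one_le_two
  have hmean (c : E n) (i : Fin n) :
      ∫ z : E n, (z i - c i) ∂(multivariateGaussian m C) = m i - c i := by
    rw [integral_sub (by simpa using hint 0 i) (integrable_const _),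
      integral_apply_multivariateGaussian]
    simp
  have hcov := covariance_eval_multivariateGaussian (μ := m) hC i j
  rw [← covariance_sub_const_left (by simpa using hint 0 i) (c i),
    ← covariance_sub_const_right (by simpa using hint 0 j) (d j),
    covariance_eq_sub (memLp_apply_sub_multivariateGaussian m C c i)
      (memLp_apply_sub_multivariateGaussian m C d j), hmean, hmean] at hcov
  simp only [Pi.mul_apply] at hcov
  linarith

lemma cov_gaussianDensity (hC : C.PosDef) : cov (gaussianDensity m C) = C := by
  ext i j
  simp only [cov, expect_gaussianDensity m hC, integral_apply_multivariateGaussian]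
  simpa using integral_apply_sub_mul_apply_sub_multivariateGaussian m hC.posSemidef m m i j

lemma dotProduct_mulVec_eq_sum {ι R : Type*} [Fintype ι] [CommSemiring R] (x y : ι → R)
    (W : Matrix ι ι R) : x ⬝ᵥ (W *ᵥ y) = ∑ i, ∑ j, W i j * (x i * y j) := by
  simp only [dotProduct, Matrix.mulVec, Finset.mul_sum]
  exact Finset.sum_congr rfl fun i _ => Finset.sum_congr rfl fun j _ => by ring

lemma integrable_apply_sub_mul_apply_sub_multivariateGaussian (c d : E n) (i j : Fin n) :
    Integrable (fun z : E n => (z i - c i) * (z j - d j)) (multivariateGaussian m C) :=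
  (memLp_apply_sub_multivariateGaussian m C c i).integrable_mul
    (memLp_apply_sub_multivariateGaussian m C d j)

lemma integrable_sub_dotProduct_mulVec_sub_multivariateGaussian (W : Matrix (Fin n) (Fin n) ℝ)
    (c d : E n) :
    Integrable (fun z : E n => (z - c).ofLp ⬝ᵥ (W *ᵥ (z - d).ofLp))
      (multivariateGaussian m C) := by
  simp only [dotProduct_mulVec_eq_sum]
  exact integrable_finsetSum _ fun i _ => integrable_finsetSum _ fun j _ =>
    (integrable_apply_sub_mul_apply_sub_multivariateGaussian m c d i j).const_mul _

lemma integral_sub_dotProduct_mulVec_sub_multivariateGaussian (hC : C.PosSemidef)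
    (W : Matrix (Fin n) (Fin n) ℝ) (c d : E n) :
    ∫ z : E n, (z - c).ofLp ⬝ᵥ (W *ᵥ (z - d).ofLp) ∂(multivariateGaussian m C) =
      (W * C).trace + (m - c).ofLp ⬝ᵥ (W *ᵥ (m - d).ofLp) := by
  have hint (i j : Fin n) :=
    (integrable_apply_sub_mul_apply_sub_multivariateGaussian m (C := C) c d i j).const_mul (W i j)
  have htrace : (W * C).trace = ∑ i, ∑ j, W i j * C i j := by
    simp only [Matrix.trace, Matrix.diag, Matrix.mul_apply]
    exact Finset.sum_congr rfl fun i _ => Finset.sum_congr rfl fun j _ => by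
      rw [← hC.isHermitian.apply i j, star_trivial]
  simp only [dotProduct_mulVec_eq_sum, WithLp.ofLp_sub, Pi.sub_apply]
  rw [integral_finsetSum _ fun i _ => integrable_finsetSum _ fun j _ => hint i j, htrace,
    ← Finset.sum_add_distrib]
  refine Finset.sum_congr rfl fun i _ => ?_
  rw [integral_finsetSum _ fun j _ => hint i j, ← Finset.sum_add_distrib]
  refine Finset.sum_congr rfl fun j _ => ?_
  rw [integral_const_mul, integral_apply_sub_mul_apply_sub_multivariateGaussian m hC, mul_add]

end Moments

section WeightedNormSq

variable {n : ℕ} {A B : Matrix (Fin n) (Fin n) ℝ}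

lemma weightedNormSq_zero (A : Matrix (Fin n) (Fin n) ℝ) : weightedNormSq A 0 = 0 := by
  simp only [weightedNormSq, WithLp.ofLp_zero, zero_dotProduct]

lemma weightedNormSq_neg (A : Matrix (Fin n) (Fin n) ℝ) (x : E n) :
    weightedNormSq A (-x) = weightedNormSq A x := by
  simp only [weightedNormSq, WithLp.ofLp_neg, Matrix.mulVec_neg, neg_dotProduct_neg]

lemma weightedNormSq_nonneg (hA : A.PosSemidef) (x : E n) : 0 ≤ weightedNormSq A x := by
  simpa [weightedNormSq] using hA.dotProduct_mulVec_nonneg x.ofLp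

lemma weightedNormSq_matrix_add (A B : Matrix (Fin n) (Fin n) ℝ) (x : E n) :
    weightedNormSq (A + B) x = weightedNormSq A x + weightedNormSq B x := by
  simp only [weightedNormSq, Matrix.add_mulVec, dotProduct_add]

lemma weightedNormSq_matrix_smul (t : ℝ) (A : Matrix (Fin n) (Fin n) ℝ) (x : E n) :
    weightedNormSq (t • A) x = t * weightedNormSq A x := by
  simp only [weightedNormSq, Matrix.smul_mulVec, dotProduct_smul, smul_eq_mul]

lemma mulVec_dotProduct_of_isHermitian {ι : Type*} [Fintype ι] {A : Matrix ι ι ℝ}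
    (hA : A.IsHermitian) (x y : ι → ℝ) : (A *ᵥ x) ⬝ᵥ y = x ⬝ᵥ (A *ᵥ y) := by
  rw [dotProduct_comm, ← Matrix.dotProduct_transpose_mulVec,
    ← Matrix.conjTranspose_eq_transpose_of_trivial, hA.eq]

lemma weightedNormSq_add (hA : A.IsHermitian) (x y : E n) :
    weightedNormSq A (x + y) =
      weightedNormSq A x + 2 * (x.ofLp ⬝ᵥ (A *ᵥ y.ofLp)) + weightedNormSq A y := by
  have hcomm : y.ofLp ⬝ᵥ (A *ᵥ x.ofLp) = x.ofLp ⬝ᵥ (A *ᵥ y.ofLp) := by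
    rw [dotProduct_comm, mulVec_dotProduct_of_isHermitian hA]
  simp only [weightedNormSq, WithLp.ofLp_add, Matrix.mulVec_add, add_dotProduct, dotProduct_add,
    hcomm]
  ring

lemma weightedNormSq_sub (hA : A.IsHermitian) (x y : E n) :
    weightedNormSq A (x - y) =
      weightedNormSq A x - 2 * (x.ofLp ⬝ᵥ (A *ᵥ y.ofLp)) + weightedNormSq A y := by
  rw [sub_eq_add_neg, weightedNormSq_add hA, weightedNormSq_neg]
  simp only [WithLp.ofLp_neg, Matrix.mulVec_neg, dotProduct_neg]
  ring

lemma exists_weightedNormSq_sub_add_eq (hA : A.PosDef) (hB : B.PosDef) (a b : E n) :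
    ∃ c : E n, ∀ z, weightedNormSq A (z - a) + weightedNormSq B (z - b) =
      weightedNormSq (A + B) (z - c) + (weightedNormSq A (c - a) + weightedNormSq B (c - b)) := by
  set c : E n := WithLp.toLp 2 ((A + B)⁻¹ *ᵥ (A *ᵥ a.ofLp + B *ᵥ b.ofLp))
  have hc : A *ᵥ (c - a).ofLp + B *ᵥ (c - b).ofLp = 0 := by
    have h : (A + B) *ᵥ c.ofLp = A *ᵥ a.ofLp + B *ᵥ b.ofLp := by
      rw [Matrix.mulVec_mulVec, Matrix.mul_nonsing_inv _ (hA.add hB).det_pos.ne'.isUnit,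
        Matrix.one_mulVec]
    rw [WithLp.ofLp_sub, WithLp.ofLp_sub, Matrix.mulVec_sub, Matrix.mulVec_sub,
      sub_add_sub_comm, ← Matrix.add_mulVec, h, sub_self]
  refine ⟨c, fun z => ?_⟩
  have hcross : (z - c).ofLp ⬝ᵥ (A *ᵥ (c - a).ofLp) + (z - c).ofLp ⬝ᵥ (B *ᵥ (c - b).ofLp) = 0 := by
    rw [← dotProduct_add, hc, dotProduct_zero]
  rw [← sub_add_sub_cancel z c a, ← sub_add_sub_cancel z c b, weightedNormSq_add hA.isHermitian,
    weightedNormSq_add hB.isHermitian, weightedNormSq_matrix_add]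
  linarith

end WeightedNormSq

section GaussianIntegral

variable {n : ℕ} {P : Matrix (Fin n) (Fin n) ℝ}

lemma integral_exp_neg_half_mul_weightedNormSq (c : E n) (hP : P.PosDef) :
    ∫ z : E n, Real.exp (-(1 / 2) * weightedNormSq P (z - c)) = √((2 * Real.pi) ^ n / P.det) := by
  have h := integral_gaussianDensity c hP.inv
  simp only [gaussianDensity, Matrix.nonsing_inv_nonsing_inv _ hP.det_pos.ne'.isUnit,
    integral_const_mul] at h
  have hpos := hP.inv.det_pos
  rw [inv_mul_eq_one₀ (by positivity)] at h
  have hdet : P⁻¹.det = P.det⁻¹ := by rw [Matrix.det_nonsing_inv, Ring.inverse_eq_inv']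
  rw [div_eq_mul_inv _ P.det, ← hdet, h]
  rfl

lemma integrable_exp_neg_half_mul_weightedNormSq (c : E n) (hP : P.PosDef) :
    Integrable fun z : E n => Real.exp (-(1 / 2) * weightedNormSq P (z - c)) := by
  have hdet := hP.det_pos
  refine Integrable.of_integral_ne_zero ?_
  rw [integral_exp_neg_half_mul_weightedNormSq c hP]
  positivity

lemma det_le_det_of_posSemidef_sub {A B : Matrix (Fin n) (Fin n) ℝ} (hA : A.PosDef)
    (hBA : (B - A).PosSemidef) : A.det ≤ B.det := by
  have hB : B.PosDef := by simpa using hA.add_posSemidef hBA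
  have hle : √((2 * Real.pi) ^ n / B.det) ≤ √((2 * Real.pi) ^ n / A.det) := by
    rw [← integral_exp_neg_half_mul_weightedNormSq 0 hA,
      ← integral_exp_neg_half_mul_weightedNormSq 0 hB]
    refine integral_mono (integrable_exp_neg_half_mul_weightedNormSq 0 hB)
      (integrable_exp_neg_half_mul_weightedNormSq 0 hA) fun z => Real.exp_le_exp.2 ?_
    have h := weightedNormSq_nonneg hBA (z - 0)
    have hadd := weightedNormSq_matrix_add A (B - A) (z - 0)
    rw [add_sub_cancel] at hadd
    linarith
  have hApos := hA.det_pos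
  have hBpos := hB.det_pos
  rwa [Real.sqrt_le_sqrt_iff (by positivity),
    div_le_div_iff_of_pos_left (by positivity) hBpos hApos] at hle

end GaussianIntegral

section KullbackLeibler

variable {n : ℕ} (m m' : E n) {A B : Matrix (Fin n) (Fin n) ℝ}

lemma log_gaussianDensity (hA : A.PosDef) (z : E n) :
    Real.log (gaussianDensity m A z) =
      -(1 / 2) * (Real.log ((2 * Real.pi) ^ n) + Real.log A.det + weightedNormSq A⁻¹ (z - m)) := by
  have hdet := hA.det_pos
  have hpi : (0 : ℝ) < (2 * Real.pi) ^ n := by positivity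
  rw [gaussianDensity, Real.log_mul (by positivity) (Real.exp_pos _).ne', Real.log_exp,
    Real.log_inv, Real.log_sqrt (by positivity), Real.log_mul hpi.ne' hdet.ne', weightedNormSq]
  ring

lemma log_gaussianDensity_div (hA : A.PosDef) (hB : B.PosDef) (z : E n) :
    Real.log (gaussianDensity m A z / gaussianDensity m' B z) =
      1 / 2 * (Real.log B.det - Real.log A.det) +
        1 / 2 * (weightedNormSq B⁻¹ (z - m') - weightedNormSq A⁻¹ (z - m)) := by
  rw [Real.log_div (gaussianDensity_pos m hA z).ne' (gaussianDensity_pos m' hB z).ne',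
    log_gaussianDensity m hA, log_gaussianDensity m' hB]
  ring

lemma expect_log_gaussianDensity_div (hA : A.PosDef) (hB : B.PosDef) :
    expect (gaussianDensity m A)
      (fun z => Real.log (gaussianDensity m A z / gaussianDensity m' B z)) =
        1 / 2 * (Real.log B.det - Real.log A.det + (B⁻¹ * A).trace - n +
          weightedNormSq B⁻¹ (m - m')) := by
  have hB_int := integrable_sub_dotProduct_mulVec_sub_multivariateGaussian m (C := A) B⁻¹ m' m'
  have hA_int := integrable_sub_dotProduct_mulVec_sub_multivariateGaussian m (C := A) A⁻¹ m m
  rw [expect_gaussianDensity m hA]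
  simp only [log_gaussianDensity_div m m' hA hB, weightedNormSq]
  rw [integral_add (integrable_const _) (by exact (hB_int.sub hA_int).const_mul _),
    integral_const, integral_const_mul, integral_sub hB_int hA_int,
    integral_sub_dotProduct_mulVec_sub_multivariateGaussian m hA.posSemidef,
    integral_sub_dotProduct_mulVec_sub_multivariateGaussian m hA.posSemidef,
    Matrix.nonsing_inv_mul _ hA.det_pos.ne'.isUnit]
  simp only [probReal_univ, one_smul, Matrix.trace_one, Fintype.card_fin, sub_self,
    WithLp.ofLp_zero, zero_dotProduct]
  ring

end KullbackLeibler

section ScoreDivergence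

variable {n : ℕ} (m m' : E n) {A B : Matrix (Fin n) (Fin n) ℝ}

lemma hasGradientAt_weightedNormSq_sub (hA : A.IsHermitian) (z : E n) :
    HasGradientAt (fun w => weightedNormSq A (w - m))
      ((2 : ℝ) • Matrix.toEuclideanLin A (z - m)) z := by
  set T := Matrix.toEuclideanCLM (𝕜 := ℝ) A
  have hinner : (fun w => weightedNormSq A (w - m)) = fun w => inner ℝ (w - m) (T (w - m)) := by
    ext w
    rw [Matrix.inner_toEuclideanCLM]
    rfl
  have hsub : HasFDerivAt (fun w => w - m) (ContinuousLinearMap.id ℝ (E n)) z :=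
    (hasFDerivAt_id z).sub_const m
  rw [hinner, hasGradientAt_iff_hasFDerivAt]
  convert! hsub.inner ℝ (T.hasFDerivAt.comp z hsub) using 1
  ext v
  have hsymm : inner ℝ (z - m) (T v) = inner ℝ (T (z - m)) v :=
    (Matrix.isSymmetric_toEuclideanLin_iff.2 hA (z - m) v).symm
  change inner ℝ ((2 : ℝ) • T (z - m)) v = inner ℝ (z - m) (T v) + inner ℝ v (T (z - m))
  rw [hsymm, real_inner_comm (T (z - m)) v, real_inner_smul_left]
  ring

lemma gradient_log_gaussianDensity_div (hA : A.PosDef) (hB : B.PosDef) (z : E n) :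
    gradient (fun w => Real.log (gaussianDensity m A w / gaussianDensity m' B w)) z =
      Matrix.toEuclideanLin B⁻¹ (z - m') - Matrix.toEuclideanLin A⁻¹ (z - m) := by
  have h := (((hasGradientAt_weightedNormSq_sub m' hB.inv.isHermitian z).hasFDerivAt.sub
    (hasGradientAt_weightedNormSq_sub m hA.inv.isHermitian z).hasFDerivAt).const_mul
      (1 / 2)).const_add (1 / 2 * (Real.log B.det - Real.log A.det))
  simp_rw [log_gaussianDensity_div m m' hA hB]
  refine HasGradientAt.gradient ?_
  rw [hasGradientAt_iff_hasFDerivAt]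
  convert! h using 1
  rw [← map_sub, ← map_smul, ← smul_sub, smul_smul]
  norm_num

lemma expect_weightedNormSq_toEuclideanLin_inv_sub (hA : A.PosDef) (hB : B.IsHermitian) :
    expect (gaussianDensity m A) (fun z => weightedNormSq A
      (Matrix.toEuclideanLin B⁻¹ (z - m') - Matrix.toEuclideanLin A⁻¹ (z - m))) =
        n - 2 * (B⁻¹ * A).trace + (B⁻¹ * A * (B⁻¹ * A)).trace +
          weightedNormSq (B⁻¹ * A * B⁻¹) (m - m') := by
  have hunit : IsUnit A.det := hA.det_pos.ne'.isUnit
  have hpt (z : E n) : weightedNormSq A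
      (Matrix.toEuclideanLin B⁻¹ (z - m') - Matrix.toEuclideanLin A⁻¹ (z - m)) =
        (z - m').ofLp ⬝ᵥ ((B⁻¹ * A * B⁻¹) *ᵥ (z - m').ofLp) -
          2 * ((z - m').ofLp ⬝ᵥ (B⁻¹ *ᵥ (z - m).ofLp)) +
          (z - m).ofLp ⬝ᵥ (A⁻¹ *ᵥ (z - m).ofLp) := by
    rw [weightedNormSq_sub hA.isHermitian]
    simp only [weightedNormSq, Matrix.toLpLin_apply,
      Matrix.mulVec_mulVec, Matrix.mul_nonsing_inv _ hunit, Matrix.one_mulVec,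
      mulVec_dotProduct_of_isHermitian hB.inv, mulVec_dotProduct_of_isHermitian hA.isHermitian.inv,
      Matrix.mul_assoc]
  have hint (W c d) := integrable_sub_dotProduct_mulVec_sub_multivariateGaussian m (C := A) W c d
  rw [expect_gaussianDensity m hA]
  simp only [hpt]
  rw [integral_add (by exact (hint _ _ _).sub ((hint _ _ _).const_mul 2)) (hint _ _ _),
    integral_sub (hint _ _ _) ((hint _ _ _).const_mul 2), integral_const_mul]
  simp only [integral_sub_dotProduct_mulVec_sub_multivariateGaussian m hA.posSemidef,
    Matrix.nonsing_inv_mul _ hunit, sub_self, WithLp.ofLp_zero, Matrix.mulVec_zero,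
    dotProduct_zero, Matrix.trace_one, Fintype.card_fin, Matrix.mul_assoc, weightedNormSq]
  ring

end ScoreDivergence

section HellingerIntegral

variable {n : ℕ} {A B : Matrix (Fin n) (Fin n) ℝ}

lemma integrable_exp_neg_half_mul_weightedNormSq_add (hA : A.PosDef) (hB : B.PosDef) (a b : E n) :
    Integrable fun z : E n =>
      Real.exp (-(1 / 2) * (weightedNormSq A (z - a) + weightedNormSq B (z - b))) := by
  obtain ⟨c, hc⟩ := exists_weightedNormSq_sub_add_eq hA hB a b
  refine ((integrable_exp_neg_half_mul_weightedNormSq c (hA.add hB)).mul_const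
    (Real.exp (-(1 / 2) * (weightedNormSq A (c - a) + weightedNormSq B (c - b))))).congr
    (.of_forall fun z => ?_)
  simp only [hc z, ← Real.exp_add]
  ring_nf

lemma integral_exp_neg_half_mul_weightedNormSq_add_le (hA : A.PosDef) (hB : B.PosDef)
    (a b : E n) :
    ∫ z : E n, Real.exp (-(1 / 2) * (weightedNormSq A (z - a) + weightedNormSq B (z - b))) ≤
      √((2 * Real.pi) ^ n / (A + B).det) := by
  obtain ⟨c, hc⟩ := exists_weightedNormSq_sub_add_eq hA hB a b
  have hrest := add_nonneg (weightedNormSq_nonneg hA.posSemidef (c - a))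
    (weightedNormSq_nonneg hB.posSemidef (c - b))
  rw [← integral_exp_neg_half_mul_weightedNormSq c (hA.add hB)]
  refine integral_mono (integrable_exp_neg_half_mul_weightedNormSq_add hA hB a b)
    (integrable_exp_neg_half_mul_weightedNormSq c (hA.add hB)) fun z => Real.exp_le_exp.2 ?_
  have hz := hc z
  linarith

lemma gaussianDensity_mul_rpow_div_rpow (μ ν : E n) (hA : A.PosDef) (hB : B.PosDef) (α : ℝ)
    (z : E n) :
    gaussianDensity ν B z * (gaussianDensity μ A z ^ α / gaussianDensity ν B z ^ α) =
      Real.exp (-(1 / 2) * (Real.log ((2 * Real.pi) ^ n) + α * Real.log A.det +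
        (1 - α) * Real.log B.det)) *
      Real.exp (-(1 / 2) * (weightedNormSq (α • A⁻¹) (z - μ) +
        weightedNormSq ((1 - α) • B⁻¹) (z - ν))) := by
  have hp := gaussianDensity_pos μ hA z
  have hq := gaussianDensity_pos ν hB z
  calc gaussianDensity ν B z * (gaussianDensity μ A z ^ α / gaussianDensity ν B z ^ α)
      = Real.exp (Real.log (gaussianDensity ν B z) + (Real.log (gaussianDensity μ A z) * α -
          Real.log (gaussianDensity ν B z) * α)) := by
        rw [Real.exp_add, Real.exp_sub, Real.exp_log hq, Real.rpow_def_of_pos hp,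
          Real.rpow_def_of_pos hq]
    _ = _ := by
        rw [← Real.exp_add, log_gaussianDensity μ hA, log_gaussianDensity ν hB,
          weightedNormSq_matrix_smul, weightedNormSq_matrix_smul]
        ring_nf

lemma det_smul_inv_add_smul_inv {ι : Type*} [Fintype ι] [DecidableEq ι] {K : Type*} [Field K]
    {A B : Matrix ι ι K} (hA : A.det ≠ 0) (hB : B.det ≠ 0) (s t : K) :
    (s • A⁻¹ + t • B⁻¹).det = (s • B + t • A).det / (A.det * B.det) := by
  have hfactor : s • A⁻¹ + t • B⁻¹ = A⁻¹ * (s • B + t • A) * B⁻¹ := by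
    simp only [mul_add, add_mul, Matrix.mul_smul, Matrix.smul_mul, mul_assoc,
      Matrix.mul_nonsing_inv _ hB.isUnit, mul_one,
      Matrix.nonsing_inv_mul _ hA.isUnit, one_mul]
  rw [hfactor, Matrix.det_mul, Matrix.det_mul, Matrix.det_nonsing_inv, Matrix.det_nonsing_inv,
    Ring.inverse_eq_inv']
  field_simp

/-- The integral `∫ p ^ α q ^ (1 - α)` for Gaussians `p`, `q` with a common mean and covariance
matrices `A`, `B`. -/
noncomputable def hellingerIntegral {ι : Type*} [Fintype ι] [DecidableEq ι] (A B : Matrix ι ι ℝ)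
    (α : ℝ) : ℝ :=
  Real.exp (-(1 / 2) * (Real.log (α • B + (1 - α) • A).det -
    (1 - α) * Real.log A.det - α * Real.log B.det))

variable {α : ℝ}

lemma exp_mul_sqrt_eq_hellingerIntegral (hA : A.PosDef) (hB : B.PosDef) (h0 : 0 < α)
    (h1 : α < 1) :
    Real.exp (-(1 / 2) * (Real.log ((2 * Real.pi) ^ n) + α * Real.log A.det +
      (1 - α) * Real.log B.det)) * √((2 * Real.pi) ^ n / (α • A⁻¹ + (1 - α) • B⁻¹).det) =
        hellingerIntegral A B α := by
  have hAdet := hA.det_pos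
  have hBdet := hB.det_pos
  have hMdet := ((hB.smul h0).add (hA.smul (sub_pos.2 h1))).det_pos
  have hpi : (0 : ℝ) < (2 * Real.pi) ^ n := by positivity
  rw [det_smul_inv_add_smul_inv hAdet.ne' hBdet.ne', ← Real.exp_log (Real.sqrt_pos.2
    (show 0 < (2 * Real.pi) ^ n / ((α • B + (1 - α) • A).det / (A.det * B.det)) by positivity)),
    Real.log_sqrt (by positivity), Real.log_div hpi.ne' (by positivity),
    Real.log_div hMdet.ne' (by positivity), Real.log_mul hAdet.ne' hBdet.ne', ← Real.exp_add,
    hellingerIntegral]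
  ring_nf

lemma integrable_gaussianDensity_mul_rpow_div_rpow (μ ν : E n) (hA : A.PosDef) (hB : B.PosDef)
    (h0 : 0 < α) (h1 : α < 1) :
    Integrable fun z =>
      gaussianDensity ν B z * (gaussianDensity μ A z ^ α / gaussianDensity ν B z ^ α) := by
  simp only [gaussianDensity_mul_rpow_div_rpow μ ν hA hB]
  exact (integrable_exp_neg_half_mul_weightedNormSq_add (hA.inv.smul h0)
    (hB.inv.smul (sub_pos.2 h1)) μ ν).const_mul _

lemma integral_gaussianDensity_mul_rpow_div_rpow_le (μ ν : E n) (hA : A.PosDef) (hB : B.PosDef)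
    (h0 : 0 < α) (h1 : α < 1) :
    ∫ z, gaussianDensity ν B z * (gaussianDensity μ A z ^ α / gaussianDensity ν B z ^ α) ≤
      hellingerIntegral A B α := by
  simp only [gaussianDensity_mul_rpow_div_rpow μ ν hA hB, integral_const_mul]
  rw [← exp_mul_sqrt_eq_hellingerIntegral hA hB h0 h1]
  exact mul_le_mul_of_nonneg_left (integral_exp_neg_half_mul_weightedNormSq_add_le
    (hA.inv.smul h0) (hB.inv.smul (sub_pos.2 h1)) μ ν) (Real.exp_nonneg _)

lemma integral_gaussianDensity_mul_rpow_div_rpow_self (μ : E n) (hA : A.PosDef) (hB : B.PosDef)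
    (h0 : 0 < α) (h1 : α < 1) :
    ∫ z, gaussianDensity μ B z * (gaussianDensity μ A z ^ α / gaussianDensity μ B z ^ α) =
      hellingerIntegral A B α := by
  simp only [gaussianDensity_mul_rpow_div_rpow μ μ hA hB, integral_const_mul,
    ← weightedNormSq_matrix_add]
  rw [integral_exp_neg_half_mul_weightedNormSq μ
    ((hA.inv.smul h0).add (hB.inv.smul (sub_pos.2 h1))),
    exp_mul_sqrt_eq_hellingerIntegral hA hB h0 h1]

end HellingerIntegral

section DiagonalMatrix

variable {ι : Type*}

/-- The set of vectors with positive coordinates, over which the marginal variances of the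
approximation range. -/
def positiveOrthant (ι : Type*) : Set (ι → ℝ) := {ψ | ∀ i, 0 < ψ i}

variable [Fintype ι] [DecidableEq ι] {ψ : ι → ℝ}

lemma inv_diagonal_of_mem_positiveOrthant (hψ : ψ ∈ positiveOrthant ι) :
    (Matrix.diagonal ψ)⁻¹ = Matrix.diagonal ψ⁻¹ := by
  refine Matrix.inv_eq_left_inv ?_
  rw [Matrix.diagonal_mul_diagonal', ← Matrix.diagonal_one]
  exact congrArg _ (funext fun i => inv_mul_cancel₀ (hψ i).ne')

lemma log_det_diagonal (hψ : ψ ∈ positiveOrthant ι) :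
    Real.log (Matrix.diagonal ψ).det = ∑ i, Real.log (ψ i) := by
  rw [Matrix.det_diagonal, Real.log_prod fun i _ => (hψ i).ne']

lemma trace_mul_diagonal (A : Matrix ι ι ℝ) (s : ι → ℝ) :
    (A * Matrix.diagonal s).trace = ∑ i, A i i * s i := by
  simp only [Matrix.trace, Matrix.diag_apply, Matrix.mul_diagonal]

lemma trace_mul_diagonal_mul_mul_diagonal {A : Matrix ι ι ℝ} (hA : A.IsHermitian) (s : ι → ℝ) :
    (A * Matrix.diagonal s * (A * Matrix.diagonal s)).trace = s ⬝ᵥ ((A ⊙ A) *ᵥ s) := by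
  have hAT : Aᵀ = A := by rw [← Matrix.conjTranspose_eq_transpose_of_trivial, hA.eq]
  rw [Matrix.dotProduct_mulVec, Matrix.dotProduct_vecMul_hadamard, Matrix.transpose_mul, hAT,
    Matrix.diagonal_transpose, Matrix.trace_mul_comm, mul_assoc, Matrix.trace_mul_comm]
  simp only [mul_assoc]

end DiagonalMatrix

section MeanProfile

variable {n : ℕ}

/-- `f` is the profile of the divergence `D` to `p` as a function of the marginal variances: for
each choice of variances, the minimum of `D` over the mean is attained at `μ` and is given by `f`.
This eliminates the mean from the minimization over the variational family. -/
def IsMeanProfile (D : Divergence n) (p : E n → ℝ) (μ : E n) (f : (Fin n → ℝ) → ℝ) : Prop :=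
  ∀ ψ ∈ positiveOrthant (Fin n),
    D (factorizedDensity μ ψ) p = f ψ ∧ ∀ ν, f ψ ≤ D (factorizedDensity ν ψ) p

lemma IsMeanProfile.of_eq_add {D : Divergence n} {p : E n → ℝ} {μ : E n} {f : (Fin n → ℝ) → ℝ}
    (W : (Fin n → ℝ) → E n → ℝ) (hW : ∀ ψ ∈ positiveOrthant (Fin n), W ψ 0 = 0 ∧ ∀ x, 0 ≤ W ψ x)
    (hD : ∀ ψ ∈ positiveOrthant (Fin n), ∀ ν, D (factorizedDensity ν ψ) p = f ψ + W ψ (ν - μ)) :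
    IsMeanProfile D p μ f := by
  refine fun ψ hψ => ⟨?_, fun ν => ?_⟩
  · rw [hD ψ hψ, sub_self, (hW ψ hψ).1, add_zero]
  · rw [hD ψ hψ]
    exact le_add_of_nonneg_right ((hW ψ hψ).2 _)

/-- The Kullback-Leibler profile: `A`, `s` are the precision matrix of the target and the variances
of the approximation for `KL(q||p)`, and the covariance matrix of the target and the precisions of
the approximation for `KL(p||q)`. -/
noncomputable def klProfile {ι : Type*} [Fintype ι] [DecidableEq ι] (A : Matrix ι ι ℝ)
    (s : ι → ℝ) : ℝ :=
  1 / 2 * (∑ i, (A i i * s i - Real.log (s i)) - Real.log A.det - Fintype.card ι)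

/-- The profile of the score-based divergences, with `A` and `s` as in `klProfile`. -/
noncomputable def scoreProfile {ι : Type*} [Fintype ι] (A : Matrix ι ι ℝ) (s : ι → ℝ) : ℝ :=
  Fintype.card ι - 2 * (∑ i, A i i * s i) + s ⬝ᵥ ((A ⊙ A) *ᵥ s)

/-- The covariance matrix interpolating between the target `C` and the approximation. -/
noncomputable def interpolant {ι : Type*} [DecidableEq ι] (C : Matrix ι ι ℝ) (α : ℝ)
    (ψ : ι → ℝ) : Matrix ι ι ℝ :=
  α • Matrix.diagonal ψ + (1 - α) • C

/-- The part of the logarithm of `∫ p ^ α q ^ (1 - α)` that depends on the variances `ψ` of `q`,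
scaled by `-2`. -/
noncomputable def renyiPotential {ι : Type*} [Fintype ι] [DecidableEq ι] (C : Matrix ι ι ℝ) (α : ℝ)
    (ψ : ι → ℝ) : ℝ :=
  Real.log (interpolant C α ψ).det - α * ∑ i, Real.log (ψ i)

/-- The function of the `renyiPotential` that gives the Rényi profile for a target with
determinant `d`. -/
noncomputable def renyiLink (d α t : ℝ) : ℝ :=
  1 / (α * (α - 1)) * (Real.exp (-(1 / 2) * (t - (1 - α) * Real.log d)) - 1)

variable (μ : E n) {C : Matrix (Fin n) (Fin n) ℝ}

lemma isMeanProfile_klReverse (hC : C.PosDef) :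
    IsMeanProfile (klReverse n) (gaussianDensity μ C) μ (klProfile C⁻¹) := by
  refine .of_eq_add (fun _ x => 1 / 2 * weightedNormSq C⁻¹ x) (fun ψ _ => ⟨?_, fun x => ?_⟩)
    fun ψ hψ ν => ?_
  · rw [weightedNormSq_zero, mul_zero]
  · exact mul_nonneg one_half_pos.le (weightedNormSq_nonneg hC.inv.posSemidef x)
  · rw [klReverse, factorizedDensity, expect_log_gaussianDensity_div ν μ (.diagonal hψ) hC,
      trace_mul_diagonal, log_det_diagonal hψ, klProfile, Finset.sum_sub_distrib,
      Matrix.det_nonsing_inv, Ring.inverse_eq_inv', Real.log_inv, Fintype.card_fin]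
    ring

lemma isMeanProfile_klForward (hC : C.PosDef) :
    IsMeanProfile (klForward n) (gaussianDensity μ C) μ (klProfile C ∘ Inv.inv) := by
  refine .of_eq_add (fun ψ x => 1 / 2 * weightedNormSq (Matrix.diagonal ψ)⁻¹ x)
    (fun ψ hψ => ⟨?_, fun x => ?_⟩) fun ψ hψ ν => ?_
  · rw [weightedNormSq_zero, mul_zero]
  · exact mul_nonneg one_half_pos.le
      (weightedNormSq_nonneg (Matrix.PosDef.diagonal hψ).inv.posSemidef x)
  · rw [klForward, factorizedDensity, expect_log_gaussianDensity_div μ ν hC (.diagonal hψ),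
      ← neg_sub ν μ, weightedNormSq_neg, log_det_diagonal hψ, Matrix.trace_mul_comm,
      inv_diagonal_of_mem_positiveOrthant hψ, trace_mul_diagonal, Function.comp_apply, klProfile,
      Finset.sum_sub_distrib, Fintype.card_fin]
    simp only [Pi.inv_apply, Real.log_inv, Finset.sum_neg_distrib]
    ring

lemma isMeanProfile_scoreReverse (hC : C.PosDef) :
    IsMeanProfile (scoreReverse n) (gaussianDensity μ C) μ (scoreProfile C⁻¹) := by
  refine .of_eq_add (fun ψ x => weightedNormSq (C⁻¹ * Matrix.diagonal ψ * C⁻¹) x)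
    (fun ψ hψ => ⟨weightedNormSq_zero _, weightedNormSq_nonneg ?_⟩) fun ψ hψ ν => ?_
  · simpa only [hC.inv.isHermitian.eq] using
      (Matrix.PosDef.diagonal hψ).posSemidef.mul_mul_conjTranspose_same C⁻¹
  · simp only [scoreReverse, factorizedDensity, cov_gaussianDensity ν (.diagonal hψ),
      gradient_log_gaussianDensity_div ν μ (.diagonal hψ) hC]
    rw [expect_weightedNormSq_toEuclideanLin_inv_sub ν μ (.diagonal hψ) hC.isHermitian,
      trace_mul_diagonal, trace_mul_diagonal_mul_mul_diagonal hC.inv.isHermitian, scoreProfile,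
      Fintype.card_fin]

lemma isMeanProfile_scoreForward (hC : C.PosDef) :
    IsMeanProfile (scoreForward n) (gaussianDensity μ C) μ (scoreProfile C ∘ Inv.inv) := by
  refine .of_eq_add
    (fun ψ x => weightedNormSq ((Matrix.diagonal ψ)⁻¹ * C * (Matrix.diagonal ψ)⁻¹) x)
    (fun ψ hψ => ⟨weightedNormSq_zero _, weightedNormSq_nonneg ?_⟩) fun ψ hψ ν => ?_
  · simpa only [(Matrix.PosDef.diagonal hψ).inv.isHermitian.eq] using
      hC.posSemidef.mul_mul_conjTranspose_same (Matrix.diagonal ψ)⁻¹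
  · have htrace : ((Matrix.diagonal ψ)⁻¹ * C * ((Matrix.diagonal ψ)⁻¹ * C)).trace =
        ψ⁻¹ ⬝ᵥ ((C ⊙ C) *ᵥ ψ⁻¹) := by
      rw [inv_diagonal_of_mem_positiveOrthant hψ, mul_assoc, Matrix.trace_mul_comm,
        ← trace_mul_diagonal_mul_mul_diagonal hC.isHermitian]
      simp only [mul_assoc]
    simp only [scoreForward, factorizedDensity, cov_gaussianDensity μ hC,
      gradient_log_gaussianDensity_div ν μ (.diagonal hψ) hC]
    simp_rw [← neg_sub (Matrix.toEuclideanLin (Matrix.diagonal ψ)⁻¹ _), weightedNormSq_neg]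
    rw [expect_weightedNormSq_toEuclideanLin_inv_sub μ ν hC (Matrix.isHermitian_diagonal ψ),
      htrace, Matrix.trace_mul_comm, inv_diagonal_of_mem_positiveOrthant hψ, trace_mul_diagonal,
      ← neg_sub ν μ, weightedNormSq_neg, Function.comp_apply, scoreProfile, Fintype.card_fin]

variable {α : ℝ}

lemma renyi_gaussianDensity (ν : E n) {B : Matrix (Fin n) (Fin n) ℝ} (hC : C.PosDef)
    (hB : B.PosDef) (h0 : 0 < α) (h1 : α < 1) :
    renyi n α (gaussianDensity ν B) (gaussianDensity μ C) = 1 / (α * (α - 1)) *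
      ((∫ z, gaussianDensity ν B z * (gaussianDensity μ C z ^ α / gaussianDensity ν B z ^ α)) -
        1) := by
  have hdensity := integral_gaussianDensity ν hB
  simp only [renyi, expect, mul_sub_one]
  rw [integral_sub (integrable_gaussianDensity_mul_rpow_div_rpow μ ν hC hB h0 h1)
    (integrable_of_integral_eq_one hdensity), hdensity, mul_sub_one]

lemma renyiLink_renyiPotential {ψ : Fin n → ℝ} (hψ : ψ ∈ positiveOrthant (Fin n)) :
    renyiLink C.det α (renyiPotential C α ψ) =
      1 / (α * (α - 1)) * (hellingerIntegral C (Matrix.diagonal ψ) α - 1) := by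
  rw [renyiLink, renyiPotential, hellingerIntegral, log_det_diagonal hψ, interpolant,
    sub_right_comm]

lemma isMeanProfile_renyi (hC : C.PosDef) (h0 : 0 < α) (h1 : α < 1) :
    IsMeanProfile (renyi n α) (gaussianDensity μ C) μ
      (renyiLink C.det α ∘ renyiPotential C α) := by
  intro ψ hψ
  have hB := Matrix.PosDef.diagonal hψ
  have hfactor : 1 / (α * (α - 1)) ≤ 0 :=
    one_div_nonpos.2 (mul_nonpos_of_nonneg_of_nonpos h0.le (sub_nonpos.2 h1.le))
  simp only [factorizedDensity, Function.comp_apply, renyiLink_renyiPotential hψ,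
    renyi_gaussianDensity μ _ hC hB h0 h1]
  refine ⟨?_, fun ν => mul_le_mul_of_nonpos_left (sub_le_sub_right ?_ 1) hfactor⟩
  · rw [integral_gaussianDensity_mul_rpow_div_rpow_self μ hC hB h0 h1]
  · exact integral_gaussianDensity_mul_rpow_div_rpow_le μ ν hC hB h0 h1

end MeanProfile

section WellPosedMin

variable {X : Type*} [TopologicalSpace X] {f : X → ℝ} {s t : Set X} {x₀ : X}

/-- Tykhonov well-posedness of the minimization of `f` over `s`: the value `f x₀` is the infimum of
`f` over `s`, and points of `s` at which `f` is close to it are close to `x₀`. The point `x₀` need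
not belong to `s`, as for score-based divergences some optimal variances may degenerate. -/
structure IsWellPosedMin (f : X → ℝ) (s : Set X) (x₀ : X) : Prop where
  mem_closure : x₀ ∈ closure s
  le_apply : ∀ x ∈ s, f x₀ ≤ f x
  continuousWithinAt : ContinuousWithinAt f s x₀
  comap_inf_principal_le : comap f (𝓝 (f x₀)) ⊓ 𝓟 s ≤ 𝓝 x₀

/-- Inf-compactness: the sublevel sets of `f` in `s` lie in compact subsets of `s`. -/
def IsInfCompactOn (f : X → ℝ) (s : Set X) : Prop :=
  ∀ a, ∃ K ⊆ s, IsCompact K ∧ ∀ x ∈ s, f x ≤ a → x ∈ K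

namespace IsWellPosedMin

lemma isGLB (h : IsWellPosedMin f s x₀) : IsGLB (f '' s) (f x₀) :=
  isGLB_of_mem_closure (Set.forall_mem_image.2 h.le_apply)
    (h.continuousWithinAt.mem_closure_image h.mem_closure)

lemma tendsto {u : ℕ → X} (h : IsWellPosedMin f s x₀) (hu : ∀ k, u k ∈ s)
    (hfu : Tendsto (f ∘ u) atTop (𝓝 (f x₀))) : Tendsto u atTop (𝓝 x₀) :=
  (tendsto_inf.2 ⟨tendsto_comap_iff.2 hfu, tendsto_principal.2 (.of_forall hu)⟩).mono_right
    h.comap_inf_principal_le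

lemma mono (h : IsWellPosedMin f s x₀) (hts : t ⊆ s) (hx₀ : x₀ ∈ closure t) :
    IsWellPosedMin f t x₀ where
  mem_closure := hx₀
  le_apply x hx := h.le_apply x (hts hx)
  continuousWithinAt := h.continuousWithinAt.mono hts
  comap_inf_principal_le :=
    (inf_le_inf_left _ (principal_mono.2 hts)).trans h.comap_inf_principal_le

lemma strictMono_comp {g : ℝ → ℝ} (h : IsWellPosedMin f s x₀) (hg : Continuous g)
    (hg_mono : StrictMono g) : IsWellPosedMin (g ∘ f) s x₀ where
  mem_closure := h.mem_closure
  le_apply x hx := hg_mono.monotone (h.le_apply x hx)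
  continuousWithinAt := hg.continuousAt.comp_continuousWithinAt h.continuousWithinAt
  comap_inf_principal_le := by
    have hind := (hg_mono.isEmbedding_of_ordConnected
      (isPreconnected_range hg).ordConnected).isInducing
    rw [← comap_comap, Function.comp_apply, ← hind.nhds_eq_comap]
    exact h.comap_inf_principal_le

end IsWellPosedMin

namespace IsInfCompactOn

lemma exists_isMinOn (h : IsInfCompactOn f s) (hf : ContinuousOn f s) (hs : s.Nonempty) :
    ∃ x ∈ s, IsMinOn f s x := by
  obtain ⟨y, hy⟩ := hs
  obtain ⟨K, hKs, hK, hsub⟩ := h (f y)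
  have hyK : y ∈ K := hsub y hy le_rfl
  obtain ⟨x, hxK, hx⟩ := hK.exists_isMinOn ⟨y, hyK⟩ (hf.mono hKs)
  refine ⟨x, hKs hxK, fun z hz => ?_⟩
  rcases le_total (f z) (f y) with hzy | hyz
  · exact hx (hsub z hz hzy)
  · exact (isMinOn_iff.1 hx y hyK).trans hyz

lemma isWellPosedMin (h : IsInfCompactOn f s) (hf : ContinuousOn f s) (hx₀ : x₀ ∈ s)
    (hmin : IsMinOn f s x₀) (huniq : ∀ x ∈ s, IsMinOn f s x → x = x₀) :
    IsWellPosedMin f s x₀ where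
  mem_closure := subset_closure hx₀
  le_apply := isMinOn_iff.1 hmin
  continuousWithinAt := hf x₀ hx₀
  comap_inf_principal_le := by
    obtain ⟨K, hKs, hK, hsub⟩ := h (f x₀ + 1)
    refine hK.le_nhds_of_unique_clusterPt ?_ fun x hx hcluster => huniq x (hKs hx) ?_
    · have hlt : {x | f x < f x₀ + 1} ∈ comap f (𝓝 (f x₀)) :=
        preimage_mem_comap (Iio_mem_nhds (lt_add_one _))
      filter_upwards [inter_mem_inf hlt (mem_principal_self s)] with x hx
      exact hsub x hx.2 (le_of_lt hx.1)
    · have : (𝓝 x ⊓ (comap f (𝓝 (f x₀)) ⊓ 𝓟 s)).NeBot := hcluster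
      have hfx : f x = f x₀ := tendsto_nhds_unique
        ((hf x (hKs hx)).mono_left (inf_le_inf_left _ inf_le_right))
        (tendsto_comap.mono_left (inf_le_right.trans inf_le_left))
      exact fun z hz => hfx.trans_le (hmin hz)

end IsInfCompactOn

end WellPosedMin

section OptimalVariances

variable {n : ℕ} {D : Divergence n} {p : E n → ℝ} {μ : E n} {f : (Fin n → ℝ) → ℝ}

lemma IsMeanProfile.isMinimizer {ψ : Fin n → ℝ} (hD : IsMeanProfile D p μ f)
    (hψ : ψ ∈ positiveOrthant (Fin n)) (hmin : IsMinOn f (positiveOrthant (Fin n)) ψ) :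
    IsMinimizer D p μ ψ := by
  refine ⟨hψ, ?_⟩
  rintro _ ⟨ν, φ, hφ, rfl⟩
  calc D (factorizedDensity μ ψ) p = f ψ := (hD ψ hψ).1
    _ ≤ f φ := hmin hφ
    _ ≤ D (factorizedDensity ν φ) p := (hD φ hφ).2 ν

lemma IsMeanProfile.isGLB_iff (hD : IsMeanProfile D p μ f) (a : ℝ) :
    IsGLB ((fun q => D q p) '' factorizedFamily n) a ↔
      IsGLB (f '' positiveOrthant (Fin n)) a := by
  refine isGLB_congr (Set.ext fun b => ⟨?_, ?_⟩) <;> rintro hb _ ⟨_, h, rfl⟩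
  · rw [← (hD _ h).1]
    exact hb ⟨_, ⟨μ, _, h, rfl⟩, rfl⟩
  · obtain ⟨ν, ψ, hψ, rfl⟩ := h
    exact (hb ⟨ψ, hψ, rfl⟩).trans ((hD ψ hψ).2 ν)

variable {X : Type*} [TopologicalSpace X] [FrechetUrysohnSpace X] {s : Set X} {x₀ : X}

/- The variances are reparametrized by `φ`, and `v` extends them continuously to the possibly
degenerate limit point `x₀`. -/
lemma IsMeanProfile.isOptimalVariances_iff {φ : X → Fin n → ℝ} {v : X → Fin n → ℝ≥0∞}
    (hD : IsMeanProfile D p μ f) (hmin : IsWellPosedMin (f ∘ φ) s x₀)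
    (hφ : φ '' s = positiveOrthant (Fin n)) (hv : ContinuousAt v x₀)
    (hvφ : ∀ x ∈ s, v x = fun i => ENNReal.ofReal (φ x i)) (w : Fin n → ℝ≥0∞) :
    IsOptimalVariances D p w ↔ w = v x₀ := by
  have hglb : IsGLB ((fun q => D q p) '' factorizedFamily n) ((f ∘ φ) x₀) := by
    rw [hD.isGLB_iff, ← hφ, ← Set.image_comp]
    exact hmin.isGLB
  constructor
  · rintro ⟨ν, ψ, L, hψ, hL, hDL, hw⟩
    obtain rfl := hL.unique hglb
    choose x hxs hx using fun k => hφ.ge (hψ k)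
    have hfx : Tendsto ((f ∘ φ) ∘ x) atTop (𝓝 ((f ∘ φ) x₀)) :=
      tendsto_of_tendsto_of_tendsto_of_le_of_le tendsto_const_nhds hDL
        (fun k => hmin.le_apply _ (hxs k)) fun k => by
          simpa only [Function.comp_apply, hx k] using (hD _ (hψ k)).2 (ν k)
    have hvx : Tendsto (v ∘ x) atTop (𝓝 (v x₀)) := hv.tendsto.comp (hmin.tendsto hxs hfx)
    refine tendsto_nhds_unique (tendsto_pi_nhds.2 hw) (hvx.congr fun k => ?_)
    rw [Function.comp_apply, hvφ _ (hxs k), hx k]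
  · rintro rfl
    obtain ⟨x, hxs, hx⟩ := mem_closure_iff_seq_limit.1 hmin.mem_closure
    have hφx (k : ℕ) : φ (x k) ∈ positiveOrthant (Fin n) := hφ.le ⟨_, hxs k, rfl⟩
    refine ⟨fun _ => μ, φ ∘ x, _, hφx, hglb, ?_, tendsto_pi_nhds.1 ?_⟩
    · refine Tendsto.congr (fun k => ((hD _ (hφx k)).1).symm) ?_
      exact hmin.continuousWithinAt.tendsto.comp
        (tendsto_nhdsWithin_iff.2 ⟨hx, .of_forall hxs⟩)
    · exact (hv.tendsto.comp hx).congr fun k => hvφ _ (hxs k)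

lemma IsMeanProfile.isOptimalVariances_iff_ofReal {ψ : Fin n → ℝ} (hD : IsMeanProfile D p μ f)
    (hmin : IsWellPosedMin f (positiveOrthant (Fin n)) ψ) (w : Fin n → ℝ≥0∞) :
    IsOptimalVariances D p w ↔ w = fun i => ENNReal.ofReal (ψ i) := by
  refine hD.isOptimalVariances_iff (φ := id) (v := fun x i => ENNReal.ofReal (x i)) hmin
    (Set.image_id _) (Continuous.continuousAt ?_) (fun _ _ => rfl) w
  exact continuous_pi fun i => ENNReal.continuous_ofReal.comp (continuous_apply i)

lemma IsMeanProfile.isOptimalVariances_iff_inv_ofReal {s₀ : Fin n → ℝ}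
    (hD : IsMeanProfile D p μ (f ∘ Inv.inv))
    (hmin : IsWellPosedMin f (positiveOrthant (Fin n)) s₀) (w : Fin n → ℝ≥0∞) :
    IsOptimalVariances D p w ↔ w = fun i => (ENNReal.ofReal (s₀ i))⁻¹ := by
  have hcomp : (f ∘ Inv.inv) ∘ Inv.inv = f := funext fun x => congrArg f (inv_inv x)
  have himage : Inv.inv '' positiveOrthant (Fin n) = positiveOrthant (Fin n) := by
    rw [Set.image_inv_eq_inv]
    exact Set.ext fun x => forall_congr' fun i => inv_pos
  refine hD.isOptimalVariances_iff (v := fun x i => (ENNReal.ofReal (x i))⁻¹)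
    (hcomp.symm ▸ hmin) himage (Continuous.continuousAt ?_) (fun x hx => ?_) w
  · exact continuous_pi fun i => (ENNReal.continuous_ofReal.comp (continuous_apply i)).inv
  · exact funext fun i => (ENNReal.ofReal_inv_of_pos (hx i)).symm

end OptimalVariances

section KullbackLeibler

lemma isInfCompactOn_positiveOrthant {ι : Type*} [Fintype ι] {f : (ι → ℝ) → ℝ} {c K : ℝ}
    (hc : 0 < c) (h : ∀ x ∈ positiveOrthant ι, c * ∑ i, |Real.log (x i)| - K ≤ f x) :
    IsInfCompactOn f (positiveOrthant ι) := by
  intro a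
  set M := (a + K) / c
  refine ⟨Set.Icc (fun _ => Real.exp (-M)) (fun _ => Real.exp M),
    fun x hx i => (Real.exp_pos _).trans_le (hx.1 i), isCompact_Icc, fun x hx hxa => ?_⟩
  have hlog (i : ι) : |Real.log (x i)| ≤ M := by
    rw [le_div_iff₀' hc]
    have hsum := mul_le_mul_of_nonneg_left (Finset.single_le_sum
      (f := fun j => |Real.log (x j)|) (fun j _ => abs_nonneg _) (Finset.mem_univ i)) hc.le
    linarith [h x hx]
  exact ⟨fun i => (Real.le_log_iff_exp_le (hx i)).1 (neg_le_of_abs_le (hlog i)),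
    fun i => (Real.log_le_iff_le_exp (hx i)).1 (le_of_abs_le (hlog i))⟩

lemma abs_le_exp_sub (t : ℝ) : |t| ≤ Real.exp t - t := by
  rcases le_total 0 t with ht | ht
  · rw [abs_of_nonneg ht]
    nlinarith [Real.quadratic_le_exp_of_nonneg ht, sq_nonneg (t - 1)]
  · rw [abs_of_nonpos ht]
    linarith [Real.exp_pos t]

variable {a s : ℝ}

lemma abs_log_sub_le_mul_sub_log (ha : 0 < a) (hs : 0 < s) :
    |Real.log s| - (|Real.log a| - Real.log a) ≤ a * s - Real.log s := by
  have hexp := abs_le_exp_sub (Real.log (a * s))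
  rw [Real.exp_log (mul_pos ha hs), Real.log_mul ha.ne' hs.ne'] at hexp
  have htri := abs_sub_abs_le_abs_add (Real.log s) (Real.log a)
  rw [add_comm (Real.log s)] at htri
  linarith

lemma one_add_log_lt_mul_sub_log (ha : 0 < a) (hs : 0 < s) (hne : s ≠ a⁻¹) :
    1 + Real.log a < a * s - Real.log s := by
  have hlt := Real.log_lt_sub_one_of_pos (mul_pos ha hs)
    fun h => hne (eq_inv_of_mul_eq_one_right h)
  rw [Real.log_mul ha.ne' hs.ne'] at hlt
  linarith

lemma isWellPosedMin_sum_mul_sub_log {ι : Type*} [Fintype ι] {a : ι → ℝ}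
    (ha : a ∈ positiveOrthant ι) :
    IsWellPosedMin (fun s => ∑ i, (a i * s i - Real.log (s i))) (positiveOrthant ι) a⁻¹ := by
  have hinv : a⁻¹ ∈ positiveOrthant ι := fun i => inv_pos.2 (ha i)
  have hvalue (i : ι) : a i * a⁻¹ i - Real.log (a⁻¹ i) = 1 + Real.log (a i) := by
    rw [Pi.inv_apply, mul_inv_cancel₀ (ha i).ne', Real.log_inv, sub_neg_eq_add]
  have hle : ∀ s ∈ positiveOrthant ι, ∀ i, 1 + Real.log (a i) ≤ a i * s i - Real.log (s i) := by
    intro s hs i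
    by_cases h : s i = a⁻¹ i
    · rw [h, hvalue]
    · exact (one_add_log_lt_mul_sub_log (ha i) (hs i) h).le
  refine (isInfCompactOn_positiveOrthant one_pos
    (K := ∑ i, (|Real.log (a i)| - Real.log (a i))) fun s hs => ?_).isWellPosedMin ?_ hinv
      (fun s hs => ?_) fun s hs hmin => ?_
  · rw [one_mul, ← Finset.sum_sub_distrib]
    exact Finset.sum_le_sum fun i _ => abs_log_sub_le_mul_sub_log (ha i) (hs i)
  · refine continuousOn_finsetSum _ fun i _ => ContinuousOn.sub (by fun_prop) ?_
    exact ContinuousOn.log (by fun_prop) fun s hs => (hs i).ne'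
  · exact Finset.sum_le_sum fun i _ => (hvalue i).trans_le (hle s hs i)
  · by_contra hne
    obtain ⟨i, hi⟩ := Function.ne_iff.1 hne
    refine (isMinOn_iff.1 hmin a⁻¹ hinv).not_gt (Finset.sum_lt_sum
      (fun j _ => (hvalue j).trans_le (hle s hs j)) ⟨i, Finset.mem_univ i, ?_⟩)
    exact (hvalue i).trans_lt (one_add_log_lt_mul_sub_log (ha i) (hs i) hi)

lemma isWellPosedMin_klProfile {ι : Type*} [Fintype ι] [DecidableEq ι] {A : Matrix ι ι ℝ}
    (hA : A.PosDef) : IsWellPosedMin (klProfile A) (positiveOrthant ι) A.diag⁻¹ := by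
  refine (isWellPosedMin_sum_mul_sub_log (a := A.diag) fun i => hA.diag_pos).strictMono_comp
    (g := fun t => 1 / 2 * (t - Real.log A.det - Fintype.card ι)) (by fun_prop) fun t u htu => ?_
  linarith

variable {n : ℕ} (μ : E n) {C : Matrix (Fin n) (Fin n) ℝ}

lemma isOptimalVariances_klReverse_iff (hC : C.PosDef) (w : Fin n → ℝ≥0∞) :
    IsOptimalVariances (klReverse n) (gaussianDensity μ C) w ↔
      w = fun i => ENNReal.ofReal (C⁻¹ i i)⁻¹ :=
  (isMeanProfile_klReverse μ hC).isOptimalVariances_iff_ofReal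
    (isWellPosedMin_klProfile hC.inv) w

lemma isOptimalVariances_klForward_iff (hC : C.PosDef) (w : Fin n → ℝ≥0∞) :
    IsOptimalVariances (klForward n) (gaussianDensity μ C) w ↔
      w = fun i => ENNReal.ofReal (C i i) := by
  simp_rw [(isMeanProfile_klForward μ hC).isOptimalVariances_iff_inv_ofReal
    (isWellPosedMin_klProfile hC), Pi.inv_apply, Matrix.diag_apply,
    ENNReal.ofReal_inv_of_pos hC.diag_pos, inv_inv]

end KullbackLeibler

section InverseDiagonal

variable {ι : Type*} [Fintype ι] [DecidableEq ι] {A B : Matrix ι ι ℝ} {i : ι}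

lemma mulVec_inv_col (hA : A.PosDef) (i : ι) : A *ᵥ A⁻¹.col i = Pi.single i 1 := by
  rw [← Matrix.mulVec_single_one, Matrix.mulVec_mulVec,
    Matrix.mul_nonsing_inv _ hA.det_pos.ne'.isUnit, Matrix.one_mulVec]

lemma two_mul_sub_dotProduct_inv_col (hA : A.PosDef) (i : ι) :
    2 * A⁻¹.col i i - A⁻¹.col i ⬝ᵥ (A *ᵥ A⁻¹.col i) = A⁻¹ i i := by
  rw [mulVec_inv_col hA, dotProduct_single_one, Matrix.col_apply]
  ring

lemma dotProduct_sub_mulVec_sub_inv_col (hA : A.PosDef) (x : ι → ℝ) (i : ι) :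
    (x - A⁻¹.col i) ⬝ᵥ (A *ᵥ (x - A⁻¹.col i)) = A⁻¹ i i - (2 * x i - x ⬝ᵥ (A *ᵥ x)) := by
  rw [Matrix.mulVec_sub, dotProduct_sub, sub_dotProduct, sub_dotProduct,
    ← mulVec_dotProduct_of_isHermitian hA.isHermitian (A⁻¹.col i) x, mulVec_inv_col hA,
    single_one_dotProduct, dotProduct_single_one, dotProduct_single_one, Matrix.col_apply]
  ring

lemma two_mul_sub_dotProduct_le_inv_apply_self (hA : A.PosDef) (x : ι → ℝ) (i : ι) :
    2 * x i - x ⬝ᵥ (A *ᵥ x) ≤ A⁻¹ i i := by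
  have hnonneg := hA.posSemidef.dotProduct_mulVec_nonneg (x - A⁻¹.col i)
  rw [star_trivial, dotProduct_sub_mulVec_sub_inv_col hA] at hnonneg
  exact sub_nonneg.1 hnonneg

lemma two_mul_sub_dotProduct_lt_inv_apply_self (hA : A.PosDef) {x : ι → ℝ}
    (hx : x ≠ A⁻¹.col i) : 2 * x i - x ⬝ᵥ (A *ᵥ x) < A⁻¹ i i := by
  have hpos := hA.dotProduct_mulVec_pos (sub_ne_zero.2 hx)
  rw [star_trivial, dotProduct_sub_mulVec_sub_inv_col hA] at hpos
  exact sub_pos.1 hpos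

lemma inv_apply_self_le_of_posSemidef_sub (hA : A.PosDef) (hBA : (B - A).PosSemidef) (i : ι) :
    B⁻¹ i i ≤ A⁻¹ i i := by
  have hB : B.PosDef := by simpa only [add_sub_cancel] using hA.add_posSemidef hBA
  have hnonneg := hBA.dotProduct_mulVec_nonneg (B⁻¹.col i)
  rw [star_trivial, Matrix.sub_mulVec, dotProduct_sub] at hnonneg
  linarith [two_mul_sub_dotProduct_inv_col hB i,
    two_mul_sub_dotProduct_le_inv_apply_self hA (B⁻¹.col i) i]

lemma inv_col_ne_zero (hA : A.PosDef) (i : ι) : A⁻¹.col i ≠ 0 := fun h =>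
  hA.inv.diag_pos.ne' (congrFun h i)

lemma inv_apply_self_lt_of_posDef_sub (hA : A.PosDef) (hBA : (B - A).PosDef) (i : ι) :
    B⁻¹ i i < A⁻¹ i i := by
  have hB : B.PosDef := by simpa only [add_sub_cancel] using hA.add hBA
  have hpos := hBA.dotProduct_mulVec_pos (inv_col_ne_zero hB i)
  rw [star_trivial, Matrix.sub_mulVec, dotProduct_sub] at hpos
  linarith [two_mul_sub_dotProduct_inv_col hB i,
    two_mul_sub_dotProduct_le_inv_apply_self hA (B⁻¹.col i) i]

lemma inv_apply_self_smul_add_smul {a b : ℝ} (hA : A.PosDef) (hB : B.PosDef) (ha : 0 < a)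
    (hb : 0 < b) (hab : a + b = 1) (i : ι) :
    ∃ u : ι → ℝ, (a • A + b • B)⁻¹ i i =
      a * (2 * u i - u ⬝ᵥ (A *ᵥ u)) + b * (2 * u i - u ⬝ᵥ (B *ᵥ u)) := by
  refine ⟨(a • A + b • B)⁻¹.col i, ?_⟩
  rw [← two_mul_sub_dotProduct_inv_col ((hA.smul ha).add (hB.smul hb)), Matrix.add_mulVec,
    Matrix.smul_mulVec, Matrix.smul_mulVec, dotProduct_add, dotProduct_smul, dotProduct_smul,
    smul_eq_mul, smul_eq_mul]
  linear_combination (- 2 * (a • A + b • B)⁻¹.col i i) * hab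

lemma inv_apply_self_smul_add_smul_le {a b : ℝ} (hA : A.PosDef) (hB : B.PosDef) (ha : 0 < a)
    (hb : 0 < b) (hab : a + b = 1) (i : ι) :
    (a • A + b • B)⁻¹ i i ≤ a * A⁻¹ i i + b * B⁻¹ i i := by
  obtain ⟨u, hu⟩ := inv_apply_self_smul_add_smul hA hB ha hb hab i
  rw [hu]
  gcongr
  · exact two_mul_sub_dotProduct_le_inv_apply_self hA u i
  · exact two_mul_sub_dotProduct_le_inv_apply_self hB u i

lemma inv_apply_self_smul_add_smul_lt {a b : ℝ} (hA : A.PosDef) (hB : B.PosDef) (ha : 0 < a)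
    (hb : 0 < b) (hab : a + b = 1) (hne : A⁻¹.col i ≠ B⁻¹.col i) :
    (a • A + b • B)⁻¹ i i < a * A⁻¹ i i + b * B⁻¹ i i := by
  obtain ⟨u, hu⟩ := inv_apply_self_smul_add_smul hA hB ha hb hab i
  rw [hu]
  have hu_ne : u ≠ A⁻¹.col i ∨ u ≠ B⁻¹.col i := by
    by_contra! h
    exact hne (h.1.symm.trans h.2)
  rcases hu_ne with h | h
  · exact add_lt_add_of_lt_of_le
      (mul_lt_mul_of_pos_left (two_mul_sub_dotProduct_lt_inv_apply_self hA h) ha)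
      (mul_le_mul_of_nonneg_left (two_mul_sub_dotProduct_le_inv_apply_self hB u i) hb.le)
  · exact add_lt_add_of_le_of_lt
      (mul_le_mul_of_nonneg_left (two_mul_sub_dotProduct_le_inv_apply_self hA u i) ha.le)
      (mul_lt_mul_of_pos_left (two_mul_sub_dotProduct_lt_inv_apply_self hB h) hb)

lemma single_inv_eq_inv_col_iff (hA : A.PosDef) :
    Pi.single i (A i i)⁻¹ = A⁻¹.col i ↔ ∀ j, j ≠ i → A j i = 0 := by
  have hii := (hA.diag_pos (i := i)).ne'
  have hmulVec : A *ᵥ Pi.single i (A i i)⁻¹ = fun j => A j i * (A i i)⁻¹ := by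
    rw [Matrix.mulVec_single]
    rfl
  rw [← (Matrix.mulVec_injective_of_isUnit hA.isUnit).eq_iff, mulVec_inv_col hA, hmulVec]
  refine ⟨fun h j hj => ?_, fun h => funext fun j => ?_⟩
  · have hji := congrFun h j
    rw [Pi.single_eq_of_ne hj] at hji
    exact (mul_eq_zero.1 hji).resolve_right (inv_ne_zero hii)
  · by_cases hj : j = i
    · rw [hj, Pi.single_eq_same, mul_inv_cancel₀ hii]
    · rw [h j hj, zero_mul, Pi.single_eq_of_ne hj]

lemma two_mul_sub_dotProduct_single_inv (hA : A.PosDef) (i : ι) :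
    2 * (Pi.single i (A i i)⁻¹ : ι → ℝ) i -
      Pi.single i (A i i)⁻¹ ⬝ᵥ (A *ᵥ Pi.single i (A i i)⁻¹) = (A i i)⁻¹ := by
  have hii := (hA.diag_pos (i := i)).ne'
  rw [single_dotProduct, Pi.single_eq_same, Matrix.mulVec_single]
  simp only [Pi.smul_apply, Matrix.col_apply, MulOpposite.smul_eq_mul_unop, MulOpposite.unop_op]
  field_simp
  ring

lemma one_le_mul_inv_apply_self (hA : A.PosDef) (i : ι) : 1 ≤ A i i * A⁻¹ i i := by
  have hle := two_mul_sub_dotProduct_le_inv_apply_self hA (Pi.single i (A i i)⁻¹) i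
  rwa [two_mul_sub_dotProduct_single_inv hA, inv_le_iff_one_le_mul₀' hA.diag_pos] at hle

lemma one_lt_mul_inv_apply_self_iff (hA : A.PosDef) :
    1 < A i i * A⁻¹ i i ↔ ∃ j, j ≠ i ∧ A j i ≠ 0 := by
  have hii := hA.diag_pos (i := i)
  have hcol := single_inv_eq_inv_col_iff hA (i := i)
  refine ⟨fun h => ?_, fun ⟨j, hj, hji⟩ => ?_⟩
  · by_contra! hzero
    have hinv : (A i i)⁻¹ = A⁻¹ i i := by
      rw [← Matrix.col_apply A⁻¹, ← hcol.2 hzero, Pi.single_eq_same]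
    rw [← hinv, mul_inv_cancel₀ hii.ne'] at h
    exact h.false
  · have hlt := two_mul_sub_dotProduct_lt_inv_apply_self hA fun h => hji (hcol.1 h j hj)
    rwa [two_mul_sub_dotProduct_single_inv hA, inv_lt_iff_one_lt_mul₀' hii] at hlt

lemma exists_one_lt_mul_inv_apply_self (hA : A.PosDef) (hdiag : ¬ A.IsDiag) :
    ∃ i, 1 < A i i * A⁻¹ i i := by
  simp only [one_lt_mul_inv_apply_self_iff hA]
  by_contra! h
  exact hdiag fun j i hji => h i j hji

end InverseDiagonal

section RenyiStationary

variable {ι : Type*} [DecidableEq ι] {C : Matrix ι ι ℝ} {α β : ℝ} {ψ φ : ι → ℝ} {i : ι}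

lemma interpolant_zero (C : Matrix ι ι ℝ) (ψ : ι → ℝ) : interpolant C 0 ψ = C := by
  rw [interpolant, zero_smul, zero_add, sub_zero, one_smul]

lemma interpolant_one (C : Matrix ι ι ℝ) (ψ : ι → ℝ) :
    interpolant C 1 ψ = Matrix.diagonal ψ := by
  rw [interpolant, one_smul, sub_self, zero_smul, add_zero]

lemma interpolant_smul_add_smul {a b : ℝ} (hab : a + b = 1) (C : Matrix ι ι ℝ) (α β : ℝ)
    (ψ : ι → ℝ) :
    interpolant C (a * α + b * β) ψ = a • interpolant C α ψ + b • interpolant C β ψ := by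
  ext j k
  simp only [interpolant, Matrix.add_apply, Matrix.smul_apply, smul_eq_mul]
  linear_combination (C j k) * (-hab)

lemma posDef_interpolant (hC : C.PosDef) (hα : α ∈ Set.Icc (0 : ℝ) 1)
    (hψ : ψ ∈ positiveOrthant ι) : (interpolant C α ψ).PosDef := by
  rcases hα.1.eq_or_lt with rfl | h0
  · rwa [interpolant_zero]
  · exact ((Matrix.PosDef.diagonal hψ).smul h0).add_posSemidef
      (hC.posSemidef.smul (sub_nonneg.2 hα.2))

lemma interpolant_apply_self (C : Matrix ι ι ℝ) (α : ℝ) (ψ : ι → ℝ) (i : ι) :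
    interpolant C α ψ i i = α * ψ i + (1 - α) * C i i := by
  rw [interpolant, Matrix.add_apply, Matrix.smul_apply, Matrix.smul_apply,
    Matrix.diagonal_apply_eq, smul_eq_mul, smul_eq_mul]

lemma posDef_smul_interpolant_sub_interpolant {c : ℝ} (hC : C.PosDef)
    (hβ : β ∈ Set.Ioo (0 : ℝ) 1) (hc : 1 < c) (hle : ∀ j, ψ j ≤ c * φ j) :
    (c • interpolant C β φ - interpolant C β ψ).PosDef := by
  have heq : c • interpolant C β φ - interpolant C β ψ =
      β • Matrix.diagonal (fun j => c * φ j - ψ j) + ((c - 1) * (1 - β)) • C := by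
    ext j k
    rcases eq_or_ne j k with rfl | hjk
    · simp only [interpolant, Matrix.add_apply, Matrix.sub_apply, Matrix.smul_apply,
        Matrix.diagonal_apply_eq, smul_eq_mul]
      ring
    · simp only [interpolant, Matrix.add_apply, Matrix.sub_apply, Matrix.smul_apply,
        Matrix.diagonal_apply_ne _ hjk, smul_eq_mul]
      ring
  rw [heq, add_comm]
  exact (hC.smul (mul_pos (sub_pos.2 hc) (sub_pos.2 hβ.2))).add_posSemidef
    ((Matrix.PosSemidef.diagonal fun j => sub_nonneg.2 (hle j)).smul hβ.1.le)

variable [Fintype ι]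

lemma interpolant_mulVec_apply (C : Matrix ι ι ℝ) (α : ℝ) (ψ u : ι → ℝ) (i : ι) :
    (interpolant C α ψ *ᵥ u) i = α * (ψ i * u i) + (1 - α) * (C *ᵥ u) i := by
  rw [interpolant, Matrix.add_mulVec, Matrix.smul_mulVec, Matrix.smul_mulVec, Pi.add_apply,
    Pi.smul_apply, Pi.smul_apply, Matrix.mulVec_diagonal, smul_eq_mul, smul_eq_mul]

lemma convexOn_inv_interpolant_apply_self (hC : C.PosDef) (hψ : ψ ∈ positiveOrthant ι) (i : ι) :
    ConvexOn ℝ (Set.Icc 0 1) fun α => (interpolant C α ψ)⁻¹ i i := by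
  refine convexOn_iff_forall_pos.2 ⟨convex_Icc 0 1, fun α hα β hβ a b ha hb hab => ?_⟩
  simp only [interpolant_smul_add_smul hab, smul_eq_mul]
  exact inv_apply_self_smul_add_smul_le (posDef_interpolant hC hα hψ)
    (posDef_interpolant hC hβ hψ) ha hb hab i

/- If two of the inverses share their `i`-th column `u`, then `diagonal ψ *ᵥ u = C *ᵥ u`, so that
`u` is that column for every `α`. -/
lemma inv_interpolant_col_injOn (hC : C.PosDef) (hψ : ψ ∈ positiveOrthant ι)
    (hi : 1 < C i i * C⁻¹ i i) :
    Set.InjOn (fun α => (interpolant C α ψ)⁻¹.col i) (Set.Icc 0 1) := by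
  intro α hα β hβ hαβ
  by_contra hne
  set u := (interpolant C α ψ)⁻¹.col i
  have hu (k : ι) : α * (ψ k * u k) + (1 - α) * (C *ᵥ u) k = (Pi.single i 1 : ι → ℝ) k := by
    rw [← interpolant_mulVec_apply, mulVec_inv_col (posDef_interpolant hC hα hψ)]
  have hu' (k : ι) : β * (ψ k * u k) + (1 - β) * (C *ᵥ u) k = (Pi.single i 1 : ι → ℝ) k := by
    rw [← interpolant_mulVec_apply, show u = _ from hαβ,
      mulVec_inv_col (posDef_interpolant hC hβ hψ)]
  have heq (k : ι) : ψ k * u k = (C *ᵥ u) k :=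
    mul_left_cancel₀ (sub_ne_zero.2 hne) (by linear_combination hu k - hu' k)
  have hψu (k : ι) : ψ k * u k = (Pi.single i 1 : ι → ℝ) k := by
    linear_combination hu k + (1 - α) * heq k
  obtain ⟨j, hj, hji⟩ := (one_lt_mul_inv_apply_self_iff hC).1 hi
  have hzero (k : ι) (hk : k ≠ i) : u k = 0 := by
    have hk' := hψu k
    rw [Pi.single_eq_of_ne hk] at hk'
    exact (mul_eq_zero.1 hk').resolve_left (hψ k).ne'
  have hCu : (C *ᵥ u) j = C j i * u i :=
    Finset.sum_eq_single i (fun k _ hk => by rw [hzero k hk, mul_zero]) (by simp)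
  rw [← heq, hzero j hj, mul_zero, zero_eq_mul, or_iff_right hji] at hCu
  simpa [hCu] using hψu i

lemma strictConvexOn_inv_interpolant_apply_self (hC : C.PosDef) (hψ : ψ ∈ positiveOrthant ι)
    (hi : 1 < C i i * C⁻¹ i i) :
    StrictConvexOn ℝ (Set.Icc 0 1) fun α => (interpolant C α ψ)⁻¹ i i := by
  refine ⟨convex_Icc 0 1, fun α hα β hβ hne a b ha hb hab => ?_⟩
  simp only [interpolant_smul_add_smul hab, smul_eq_mul]
  exact inv_apply_self_smul_add_smul_lt (posDef_interpolant hC hα hψ)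
    (posDef_interpolant hC hβ hψ) ha hb hab ((inv_interpolant_col_injOn hC hψ hi).ne hα hβ hne)

/-- The first-order optimality condition for `renyiPotential C α` at `ψ`. -/
def IsRenyiStationary (C : Matrix ι ι ℝ) (α : ℝ) (ψ : ι → ℝ) : Prop :=
  ∀ i, (interpolant C α ψ)⁻¹ i i = (ψ i)⁻¹

lemma inv_interpolant_one_apply_self (C : Matrix ι ι ℝ) (hψ : ψ ∈ positiveOrthant ι) (i : ι) :
    (interpolant C 1 ψ)⁻¹ i i = (ψ i)⁻¹ := by
  rw [interpolant_one, inv_diagonal_of_mem_positiveOrthant hψ, Matrix.diagonal_apply_eq,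
    Pi.inv_apply]

namespace IsRenyiStationary

/- If `c = max ψ j / φ j` were larger than `1`, then `c • interpolant C β φ` would strictly dominate
`interpolant C β ψ`, contradicting the inequality at the coordinate attaining the maximum. -/
lemma le_of_inv_apply_self_le (h : IsRenyiStationary C β φ) (hC : C.PosDef)
    (hβ : β ∈ Set.Ioo (0 : ℝ) 1) (hφ : φ ∈ positiveOrthant ι) (hψ : ψ ∈ positiveOrthant ι)
    (hsub : ∀ i, (interpolant C β ψ)⁻¹ i i ≤ (ψ i)⁻¹) (i : ι) : ψ i ≤ φ i := by
  have : Nonempty ι := ⟨i⟩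
  obtain ⟨k, hk⟩ := Finite.exists_max fun j => ψ j / φ j
  by_contra! hlt
  set c := ψ k / φ k
  have hc_one : 1 < c := ((one_lt_div (hφ i)).2 hlt).trans_le (hk i)
  have hM := posDef_interpolant hC (Set.Ioo_subset_Icc_self hβ) hφ
  have hstrict := inv_apply_self_lt_of_posDef_sub
    (posDef_interpolant hC (Set.Ioo_subset_Icc_self hβ) hψ)
    (posDef_smul_interpolant_sub_interpolant hC hβ hc_one fun j => (div_le_iff₀ (hφ j)).1 (hk j)) k
  have hinv : (c • interpolant C β φ)⁻¹ k k = (ψ k)⁻¹ := by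
    have := invertibleOfNonzero (one_pos.trans hc_one).ne'
    rw [Matrix.inv_smul _ c hM.det_pos.ne'.isUnit, Matrix.smul_apply, h k, invOf_eq_inv,
      smul_eq_mul, ← mul_inv, div_mul_cancel₀ _ (hφ k).ne']
  exact (hstrict.trans_le (hsub k)).ne hinv

lemma lt_of_inv_apply_self_lt (h : IsRenyiStationary C β φ) (hC : C.PosDef)
    (hβ : β ∈ Set.Ioo (0 : ℝ) 1) (hψ : ψ ∈ positiveOrthant ι)
    (hle : ∀ j, ψ j ≤ φ j) (hi : (interpolant C β ψ)⁻¹ i i < (ψ i)⁻¹) : ψ i < φ i := by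
  refine (hle i).lt_of_ne fun heq => hi.not_ge ?_
  have hsub : (interpolant C β φ - interpolant C β ψ).PosSemidef := by
    rw [interpolant, interpolant, add_sub_add_right_eq_sub, ← smul_sub, Matrix.diagonal_sub]
    exact (Matrix.PosSemidef.diagonal fun j => sub_nonneg.2 (hle j)).smul hβ.1.le
  rw [heq, ← h i]
  exact inv_apply_self_le_of_posSemidef_sub
    (posDef_interpolant hC (Set.Ioo_subset_Icc_self hβ) hψ) hsub i

lemma eq_of_mem_positiveOrthant (hψ : IsRenyiStationary C α ψ) (hφ : IsRenyiStationary C α φ)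
    (hC : C.PosDef) (hα : α ∈ Set.Ioo (0 : ℝ) 1) (hψ_pos : ψ ∈ positiveOrthant ι)
    (hφ_pos : φ ∈ positiveOrthant ι) : ψ = φ :=
  funext fun i => le_antisymm
    (hφ.le_of_inv_apply_self_le hC hα hφ_pos hψ_pos (fun j => (hψ j).le) i)
    (hψ.le_of_inv_apply_self_le hC hα hψ_pos hφ_pos (fun j => (hφ j).le) i)

lemma inv_inv_apply_self_le (h : IsRenyiStationary C α ψ) (hC : C.PosDef)
    (hα : α ∈ Set.Ioo (0 : ℝ) 1) (hψ : ψ ∈ positiveOrthant ι) (i : ι) : (C⁻¹ i i)⁻¹ ≤ ψ i := by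
  have hle := (convexOn_inv_interpolant_apply_self hC hψ i).le_left_of_right_le
    unitInterval.zero_mem unitInterval.one_mem (by rwa [openSegment_eq_Ioo one_pos])
    (by rw [inv_interpolant_one_apply_self C hψ, h i])
  rw [h i, interpolant_zero] at hle
  exact inv_le_of_inv_le₀ (hψ i) hle

lemma inv_inv_apply_self_lt (h : IsRenyiStationary C α ψ) (hC : C.PosDef)
    (hα : α ∈ Set.Ioo (0 : ℝ) 1) (hψ : ψ ∈ positiveOrthant ι) (hi : 1 < C i i * C⁻¹ i i) :
    (C⁻¹ i i)⁻¹ < ψ i := by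
  have hlt := (strictConvexOn_inv_interpolant_apply_self hC hψ hi).lt_on_openSegment
    unitInterval.zero_mem unitInterval.one_mem zero_ne_one (by rwa [openSegment_eq_Ioo one_pos])
  rw [h i, interpolant_zero, inv_interpolant_one_apply_self C hψ, lt_max_iff,
    or_iff_left (lt_irrefl _)] at hlt
  exact inv_lt_of_inv_lt₀ (hψ i) hlt

lemma le_apply_self (h : IsRenyiStationary C α ψ) (hC : C.PosDef) (hα : α ∈ Set.Ioo (0 : ℝ) 1)
    (hψ : ψ ∈ positiveOrthant ι) (i : ι) : ψ i ≤ C i i := by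
  have hle := one_le_mul_inv_apply_self
    (posDef_interpolant hC (Set.Ioo_subset_Icc_self hα) hψ) i
  rw [h i, interpolant_apply_self, ← div_eq_mul_inv, one_le_div (hψ i)] at hle
  exact le_of_mul_le_mul_left (by linarith) (sub_pos.2 hα.2)

lemma lt_apply_self (h : IsRenyiStationary C α ψ) (hC : C.PosDef) (hα : α ∈ Set.Ioo (0 : ℝ) 1)
    (hψ : ψ ∈ positiveOrthant ι) (hi : 1 < C i i * C⁻¹ i i) : ψ i < C i i := by
  obtain ⟨j, hj, hji⟩ := (one_lt_mul_inv_apply_self_iff hC).1 hi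
  have hji' : interpolant C α ψ j i ≠ 0 := by
    rw [interpolant, Matrix.add_apply, Matrix.smul_apply, Matrix.smul_apply,
      Matrix.diagonal_apply_ne _ hj, smul_zero, zero_add]
    exact smul_ne_zero (sub_ne_zero.2 hα.2.ne') hji
  have hlt := (one_lt_mul_inv_apply_self_iff
    (posDef_interpolant hC (Set.Ioo_subset_Icc_self hα) hψ)).2 ⟨j, hj, hji'⟩
  rw [h i, interpolant_apply_self, ← div_eq_mul_inv, one_lt_div (hψ i)] at hlt
  exact lt_of_mul_lt_mul_left (by linarith) (sub_nonneg.2 hα.2.le)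

lemma inv_interpolant_apply_self_le (h : IsRenyiStationary C α ψ) (hC : C.PosDef) (hα : 0 ≤ α)
    (hβ : β ∈ Set.Ioo α 1) (hψ : ψ ∈ positiveOrthant ι) (i : ι) :
    (interpolant C β ψ)⁻¹ i i ≤ (ψ i)⁻¹ := by
  have hα_one := hβ.1.trans hβ.2
  have hle := (convexOn_inv_interpolant_apply_self hC hψ i).le_on_segment
    ⟨hα, hα_one.le⟩ unitInterval.one_mem
    (by rw [segment_eq_Icc hα_one.le]; exact Set.Ioo_subset_Icc_self hβ)
  rwa [h i, inv_interpolant_one_apply_self C hψ, max_self] at hle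

lemma inv_interpolant_apply_self_lt (h : IsRenyiStationary C α ψ) (hC : C.PosDef) (hα : 0 ≤ α)
    (hβ : β ∈ Set.Ioo α 1) (hψ : ψ ∈ positiveOrthant ι) (hi : 1 < C i i * C⁻¹ i i) :
    (interpolant C β ψ)⁻¹ i i < (ψ i)⁻¹ := by
  have hα_one := hβ.1.trans hβ.2
  have hlt := (strictConvexOn_inv_interpolant_apply_self hC hψ hi).lt_on_openSegment
    ⟨hα, hα_one.le⟩ unitInterval.one_mem hα_one.ne (by rwa [openSegment_eq_Ioo hα_one])
  rwa [h i, inv_interpolant_one_apply_self C hψ, max_self] at hlt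

lemma mono (hψ : IsRenyiStationary C α ψ) (hφ : IsRenyiStationary C β φ) (hC : C.PosDef)
    (hα : 0 < α) (hβ : β ∈ Set.Ioo α 1) (hψ_pos : ψ ∈ positiveOrthant ι)
    (hφ_pos : φ ∈ positiveOrthant ι) (i : ι) : ψ i ≤ φ i :=
  hφ.le_of_inv_apply_self_le hC ⟨hα.trans hβ.1, hβ.2⟩ hφ_pos hψ_pos
    (hψ.inv_interpolant_apply_self_le hC hα.le hβ hψ_pos) i

lemma strictMono (hψ : IsRenyiStationary C α ψ) (hφ : IsRenyiStationary C β φ) (hC : C.PosDef)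
    (hα : 0 < α) (hβ : β ∈ Set.Ioo α 1) (hψ_pos : ψ ∈ positiveOrthant ι)
    (hφ_pos : φ ∈ positiveOrthant ι) (hi : 1 < C i i * C⁻¹ i i) : ψ i < φ i :=
  hφ.lt_of_inv_apply_self_lt hC ⟨hα.trans hβ.1, hβ.2⟩ hψ_pos
    (hψ.mono hφ hC hα hβ hψ_pos hφ_pos)
    (hψ.inv_interpolant_apply_self_lt hC hα.le hβ hψ_pos hi)

end IsRenyiStationary

end RenyiStationary

section RenyiMinimum

variable {ι : Type*} [DecidableEq ι]

open MatrixOrder in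
lemma exists_pos_posSemidef_sub_smul_one [Finite ι] {C : Matrix ι ι ℝ}
    (hC : C.PosDef) :
    ∃ c : ℝ, 0 < c ∧ (C - c • (1 : Matrix ι ι ℝ)).PosSemidef := by
  cases nonempty_fintype ι
  rcases isEmpty_or_nonempty ι with hι | hι
  · exact ⟨1, one_pos, by rw [Subsingleton.elim (C - _) 0]; exact .zero⟩
  · obtain ⟨c, hc, hle⟩ := (CFC.exists_pos_algebraMap_le_iff hC.isHermitian).2
      fun x hx => hC.isStrictlyPositive.spectrum_pos hx
    exact ⟨c, hc, by rwa [Algebra.algebraMap_eq_smul_one, Matrix.le_iff] at hle⟩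

lemma interpolant_update (C : Matrix ι ι ℝ) (α : ℝ) (ψ : ι → ℝ) (i : ι) (t : ℝ) :
    interpolant C α (Function.update ψ i t) =
      interpolant C α ψ + Matrix.single i i (α * (t - ψ i)) := by
  have hdiag : Matrix.diagonal (Function.update ψ i t) =
      Matrix.diagonal ψ + Matrix.single i i (t - ψ i) := by
    rw [← Matrix.diagonal_single, Matrix.diagonal_add]
    refine congrArg _ (funext fun j => ?_)
    rcases eq_or_ne j i with rfl | hj
    · rw [Function.update_self, Pi.single_eq_same, add_sub_cancel]
    · rw [Function.update_of_ne hj, Pi.single_eq_of_ne hj, add_zero]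
  rw [interpolant, interpolant, hdiag, smul_add, Matrix.smul_single, smul_eq_mul]
  abel

variable [Fintype ι]

lemma det_add_single {R : Type*} [CommRing R] (M : Matrix ι ι R) (i : ι) (t : R) :
    (M + Matrix.single i i t).det = M.det + t * M.adjugate i i := by
  have hupdate : M + Matrix.single i i t = M.updateRow i (M i + t • Pi.single i 1) := by
    ext j k
    rcases eq_or_ne j i with rfl | hj
    · simp [Matrix.single_apply, Pi.single_apply, eq_comm]
    · simp [hj, hj.symm, Matrix.updateRow_ne]
  rw [hupdate, Matrix.det_updateRow_add, Matrix.updateRow_eq_self, Matrix.det_updateRow_smul,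
    Matrix.adjugate_apply]

variable {C : Matrix ι ι ℝ} {α : ℝ} {ψ : ι → ℝ}

lemma hasDerivAt_renyiPotential_update (hC : C.PosDef) (hα : α ∈ Set.Icc (0 : ℝ) 1)
    (hψ : ψ ∈ positiveOrthant ι) (i : ι) :
    HasDerivAt (fun t => renyiPotential C α (Function.update ψ i t))
      (α * ((interpolant C α ψ)⁻¹ i i - (ψ i)⁻¹)) (ψ i) := by
  have hdet := (posDef_interpolant hC hα hψ).det_pos.ne'
  have hlogdet : HasDerivAt (fun t => Real.log (interpolant C α (Function.update ψ i t)).det)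
      (α * (interpolant C α ψ)⁻¹ i i) (ψ i) := by
    have haffine : HasDerivAt (fun t => (interpolant C α ψ).det +
        α * (t - ψ i) * (interpolant C α ψ).adjugate i i)
        (α * 1 * (interpolant C α ψ).adjugate i i) (ψ i) :=
      ((((hasDerivAt_id' _).sub_const _).const_mul α).mul_const _).const_add _
    simp only [interpolant_update, det_add_single]
    convert! haffine.log _ using 1
    · simp [Matrix.inv_def, div_eq_inv_mul, mul_left_comm]
    · simpa using hdet
  have hlog : HasDerivAt (fun t => ∑ j, Real.log (Function.update ψ i t j)) (ψ i)⁻¹ (ψ i) := by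
    have hsum (t : ℝ) : ∑ j, Real.log (Function.update ψ i t j) =
        Real.log t + ∑ j ∈ Finset.univ \ {i}, Real.log (ψ j) := by
      rw [← Finset.sum_update_of_mem (Finset.mem_univ i), ← Function.comp_def Real.log ψ,
        ← Function.comp_update]
      rfl
    simp only [hsum]
    exact (Real.hasDerivAt_log (hψ i).ne').add_const _
  rw [mul_sub]
  exact hlogdet.sub (hlog.const_mul α)

lemma isRenyiStationary_of_isMinOn (hC : C.PosDef) (hα : α ∈ Set.Ioo (0 : ℝ) 1)
    (hψ : ψ ∈ positiveOrthant ι)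
    (hmin : IsMinOn (renyiPotential C α) (positiveOrthant ι) ψ) : IsRenyiStationary C α ψ := by
  intro i
  have hloc : IsLocalMin (fun t => renyiPotential C α (Function.update ψ i t)) (ψ i) := by
    filter_upwards [lt_mem_nhds (hψ i)] with t ht
    rw [Function.update_eq_self]
    exact hmin ((Function.forall_update_iff ψ fun _ x => 0 < x).2 ⟨ht, fun j _ => hψ j⟩)
  have hderiv := hloc.hasDerivAt_eq_zero
    (hasDerivAt_renyiPotential_update hC (Set.Ioo_subset_Icc_self hα) hψ i)
  exact sub_eq_zero.1 ((mul_eq_zero.1 hderiv).resolve_left hα.1.ne')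

lemma min_mul_abs_log_sub_le {b x : ℝ} (hα : α ∈ Set.Ioo (0 : ℝ) 1) (hb : 0 < b) (hx : 0 < x) :
    min α (1 - α) * |Real.log x| - (|Real.log α| + |Real.log b|) ≤
      Real.log (α * x + b) - α * Real.log x := by
  have hαx := mul_pos hα.1 hx
  rcases le_total 0 (Real.log x) with hlog | hlog
  · have hle := Real.log_le_log hαx (le_add_of_nonneg_right hb.le)
    rw [Real.log_mul hα.1.ne' hx.ne'] at hle
    rw [abs_of_nonneg hlog]
    linarith [mul_le_mul_of_nonneg_right (min_le_right α (1 - α)) hlog,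
      neg_abs_le (Real.log α), abs_nonneg (Real.log b)]
  · have hle := Real.log_le_log hb (le_add_of_nonneg_left hαx.le)
    rw [abs_of_nonpos hlog]
    linarith [mul_le_mul_of_nonneg_right (min_le_left α (1 - α)) (neg_nonneg.2 hlog),
      neg_abs_le (Real.log b), abs_nonneg (Real.log α)]

lemma continuousOn_renyiPotential (hC : C.PosDef) (hα : α ∈ Set.Icc (0 : ℝ) 1) :
    ContinuousOn (renyiPotential C α) (positiveOrthant ι) := by
  have hdet : Continuous fun ψ => (interpolant C α ψ).det := by
    unfold interpolant
    fun_prop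
  refine ContinuousOn.sub ?_ (continuousOn_const.mul (continuousOn_finsetSum _ fun i _ => ?_))
  · exact hdet.continuousOn.log fun ψ hψ => (posDef_interpolant hC hα hψ).det_pos.ne'
  · exact (continuous_apply i).continuousOn.log fun ψ hψ => (hψ i).ne'

variable {n : ℕ} {C : Matrix (Fin n) (Fin n) ℝ}

lemma sum_log_sub_le_renyiPotential {ψ : Fin n → ℝ} {c : ℝ} (hα : α ∈ Set.Ioo (0 : ℝ) 1)
    (hψ : ψ ∈ positiveOrthant (Fin n)) (hc : 0 < c)
    (hC : (C - c • (1 : Matrix (Fin n) (Fin n) ℝ)).PosSemidef) :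
    ∑ i, (Real.log (α * ψ i + (1 - α) * c) - α * Real.log (ψ i)) ≤ renyiPotential C α ψ := by
  have hpos : (fun i => α * ψ i + (1 - α) * c) ∈ positiveOrthant (Fin n) := fun i =>
    add_pos (mul_pos hα.1 (hψ i)) (mul_pos (sub_pos.2 hα.2) hc)
  have hsub : interpolant C α ψ - Matrix.diagonal (fun i => α * ψ i + (1 - α) * c) =
      (1 - α) • (C - c • (1 : Matrix (Fin n) (Fin n) ℝ)) := by
    ext j k
    rcases eq_or_ne j k with rfl | hjk
    · simp only [interpolant, Matrix.add_apply, Matrix.sub_apply, Matrix.smul_apply,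
        Matrix.diagonal_apply_eq, Matrix.one_apply_eq, smul_eq_mul]
      ring
    · simp only [interpolant, Matrix.add_apply, Matrix.sub_apply, Matrix.smul_apply,
        Matrix.diagonal_apply_ne _ hjk, Matrix.one_apply_ne hjk, smul_eq_mul]
      ring
  have hdet : (Matrix.diagonal fun i => α * ψ i + (1 - α) * c).det ≤ (interpolant C α ψ).det :=
    det_le_det_of_posSemidef_sub (.diagonal hpos) (hsub ▸ hC.smul (sub_nonneg.2 hα.2.le))
  rw [renyiPotential, Finset.sum_sub_distrib, ← Finset.mul_sum, ← log_det_diagonal hpos]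
  exact sub_le_sub_right (Real.log_le_log (Matrix.PosDef.diagonal hpos).det_pos hdet) _

lemma isInfCompactOn_renyiPotential (hC : C.PosDef) (hα : α ∈ Set.Ioo (0 : ℝ) 1) :
    IsInfCompactOn (renyiPotential C α) (positiveOrthant (Fin n)) := by
  obtain ⟨c, hc, hCc⟩ := exists_pos_posSemidef_sub_smul_one hC
  refine isInfCompactOn_positiveOrthant (lt_min hα.1 (sub_pos.2 hα.2))
    (K := ∑ _i : Fin n, (|Real.log α| + |Real.log ((1 - α) * c)|)) fun ψ hψ => ?_
  rw [Finset.mul_sum, ← Finset.sum_sub_distrib]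
  exact (Finset.sum_le_sum fun i _ => min_mul_abs_log_sub_le hα
    (mul_pos (sub_pos.2 hα.2) hc) (hψ i)).trans (sum_log_sub_le_renyiPotential hα hψ hc hCc)

lemma exists_isMinOn_renyiPotential (hC : C.PosDef) (hα : α ∈ Set.Ioo (0 : ℝ) 1) :
    ∃ ψ ∈ positiveOrthant (Fin n), IsMinOn (renyiPotential C α) (positiveOrthant (Fin n)) ψ :=
  (isInfCompactOn_renyiPotential hC hα).exists_isMinOn
    (continuousOn_renyiPotential hC (Set.Ioo_subset_Icc_self hα)) ⟨1, fun _ => one_pos⟩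

lemma isWellPosedMin_renyiPotential {ψ : Fin n → ℝ} (hC : C.PosDef)
    (hα : α ∈ Set.Ioo (0 : ℝ) 1) (hψ : ψ ∈ positiveOrthant (Fin n))
    (hmin : IsMinOn (renyiPotential C α) (positiveOrthant (Fin n)) ψ) :
    IsWellPosedMin (renyiPotential C α) (positiveOrthant (Fin n)) ψ :=
  (isInfCompactOn_renyiPotential hC hα).isWellPosedMin
    (continuousOn_renyiPotential hC (Set.Ioo_subset_Icc_self hα)) hψ hmin fun _ hφ hφ_min =>
      (isRenyiStationary_of_isMinOn hC hα hφ hφ_min).eq_of_mem_positiveOrthant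
        (isRenyiStationary_of_isMinOn hC hα hψ hmin) hC hα hφ hψ

lemma continuous_renyiLink (d α : ℝ) : Continuous (renyiLink d α) := by
  unfold renyiLink
  fun_prop

lemma strictMono_renyiLink (d : ℝ) (hα : α ∈ Set.Ioo (0 : ℝ) 1) : StrictMono (renyiLink d α) := by
  intro s t hst
  have hfactor : 1 / (α * (α - 1)) < 0 :=
    one_div_neg.2 (mul_neg_of_pos_of_neg hα.1 (sub_neg.2 hα.2))
  refine mul_lt_mul_of_neg_left (sub_lt_sub_right (Real.exp_lt_exp.2 ?_) 1) hfactor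
  linarith

variable (μ : E n)

lemma exists_isRenyiStationary_isMinimizer (hC : C.PosDef) (hα : α ∈ Set.Ioo (0 : ℝ) 1) :
    ∃ ψ ∈ positiveOrthant (Fin n), IsRenyiStationary C α ψ ∧
      IsMinimizer (renyi n α) (gaussianDensity μ C) μ ψ ∧
      ∀ w, IsOptimalVariances (renyi n α) (gaussianDensity μ C) w ↔
        w = fun i => ENNReal.ofReal (ψ i) := by
  obtain ⟨ψ, hψ, hmin⟩ := exists_isMinOn_renyiPotential hC hα
  have hlink := strictMono_renyiLink C.det hα
  have hprofile := isMeanProfile_renyi μ hC hα.1 hα.2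
  exact ⟨ψ, hψ, isRenyiStationary_of_isMinOn hC hα hψ hmin,
    hprofile.isMinimizer hψ fun φ hφ => hlink.monotone (hmin hφ),
    hprofile.isOptimalVariances_iff_ofReal
      ((isWellPosedMin_renyiPotential hC hα hψ hmin).strictMono_comp
        (continuous_renyiLink C.det α) hlink)⟩

end RenyiMinimum

section ScoreProfile

lemma Ici_zero_subset_closure_positiveOrthant (ι : Type*) :
    Set.Ici 0 ⊆ closure (positiveOrthant ι) := by
  have heq : positiveOrthant ι = Set.univ.pi fun _ => Set.Ioi 0 :=
    Set.ext fun s => Set.mem_univ_pi.symm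
  rw [heq, closure_pi_set]
  simp only [closure_Ioi, Set.pi_univ_Ici]
  exact subset_rfl

variable {ι : Type*} [Fintype ι] {A : Matrix ι ι ℝ} {s : ι → ℝ} {i : ι}

lemma continuous_scoreProfile (A : Matrix ι ι ℝ) : Continuous (scoreProfile A) := by
  unfold scoreProfile
  fun_prop

lemma scoreProfile_add_smul (hA : A.IsHermitian) (s d : ι → ℝ) (t : ℝ) :
    scoreProfile A (s + t • d) = scoreProfile A s + t * (2 * (d ⬝ᵥ ((A ⊙ A) *ᵥ s - A.diag))) +
      t ^ 2 * (d ⬝ᵥ ((A ⊙ A) *ᵥ d)) := by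
  have hsymm : s ⬝ᵥ ((A ⊙ A) *ᵥ d) = d ⬝ᵥ ((A ⊙ A) *ᵥ s) := by
    rw [Matrix.dotProduct_mulVec, ← Matrix.mulVec_transpose, Matrix.transpose_hadamard,
      ← Matrix.conjTranspose_eq_transpose_of_trivial, hA.eq, dotProduct_comm]
  have hlinear : ∑ j, A j j * (s + t • d) j = ∑ j, A j j * s j + t * (d ⬝ᵥ A.diag) := by
    rw [dotProduct, Finset.mul_sum, ← Finset.sum_add_distrib]
    refine Finset.sum_congr rfl fun j _ => ?_
    rw [Pi.add_apply, Pi.smul_apply, Matrix.diag_apply, smul_eq_mul]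
    ring
  simp only [scoreProfile, hlinear, Matrix.mulVec_add, Matrix.mulVec_smul, add_dotProduct,
    dotProduct_add, smul_dotProduct, dotProduct_smul, dotProduct_sub, smul_eq_mul, hsymm]
  ring

lemma strictConvexOn_scoreProfile (hA : A.PosDef) :
    StrictConvexOn ℝ Set.univ (scoreProfile A) := by
  refine ⟨convex_univ, fun x _ y _ hxy a b ha hb hab => ?_⟩
  obtain rfl := eq_sub_of_add_eq hab
  have hcomb : (1 - b) • x + b • y = x + b • (y - x) := by module
  have hy := scoreProfile_add_smul hA.isHermitian x (y - x) 1
  rw [one_smul, add_sub_cancel] at hy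
  have hpos : 0 < (y - x) ⬝ᵥ ((A ⊙ A) *ᵥ (y - x)) := by
    simpa using (hA.hadamard hA).dotProduct_mulVec_pos (sub_ne_zero.2 hxy.symm)
  rw [hcomb, scoreProfile_add_smul hA.isHermitian, hy, smul_eq_mul, smul_eq_mul]
  linarith [mul_pos (mul_pos ha hb) hpos]

lemma hadamard_self_mulVec_apply (A : Matrix ι ι ℝ) (s : ι → ℝ) (i : ι) :
    ((A ⊙ A) *ᵥ s) i = ∑ j, A i j ^ 2 * s j := by
  simp only [Matrix.mulVec, dotProduct, Matrix.hadamard_apply, ← sq]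

lemma sq_mul_le_hadamard_mulVec (A : Matrix ι ι ℝ) (hs : s ∈ Set.Ici 0) (i : ι) :
    A i i ^ 2 * s i ≤ ((A ⊙ A) *ᵥ s) i := by
  rw [hadamard_self_mulVec_apply]
  exact Finset.single_le_sum (f := fun j => A i j ^ 2 * s j)
    (fun j _ => mul_nonneg (sq_nonneg _) (hs j)) (Finset.mem_univ i)

lemma sq_mul_sub_one_le_scoreProfile (A : Matrix ι ι ℝ) (hs : s ∈ Set.Ici 0) (i : ι) :
    (A i i * s i - 1) ^ 2 ≤ scoreProfile A s := by
  calc (A i i * s i - 1) ^ 2 ≤ ∑ j, (A j j * s j - 1) ^ 2 :=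
        Finset.single_le_sum (f := fun j => (A j j * s j - 1) ^ 2) (fun j _ => sq_nonneg _)
          (Finset.mem_univ i)
    _ = Fintype.card ι - 2 * (∑ j, A j j * s j) + ∑ j, s j * (A j j ^ 2 * s j) := by
        rw [Fintype.card_eq_sum_ones, Finset.mul_sum, Nat.cast_sum, ← Finset.sum_sub_distrib,
          ← Finset.sum_add_distrib]
        exact Finset.sum_congr rfl fun j _ => by rw [Nat.cast_one]; ring
    _ ≤ scoreProfile A s := add_le_add_right (Finset.sum_le_sum fun j _ =>
        mul_le_mul_of_nonneg_left (sq_mul_le_hadamard_mulVec A hs j) (hs j)) _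

lemma isInfCompactOn_scoreProfile (hA : A.PosDef) :
    IsInfCompactOn (scoreProfile A) (Set.Ici 0) := by
  intro a
  refine ⟨Set.Icc 0 fun i => (1 + √a) / A i i, Set.Icc_subset_Ici_self, isCompact_Icc,
    fun s hs hsa => ⟨hs, fun i => ?_⟩⟩
  have hsqrt := Real.abs_le_sqrt ((sq_mul_sub_one_le_scoreProfile A hs i).trans hsa)
  rw [le_div_iff₀' hA.diag_pos]
  linarith [le_of_abs_le hsqrt]

lemma exists_isMinOn_scoreProfile (hA : A.PosDef) :
    ∃ s ∈ Set.Ici (0 : ι → ℝ), IsMinOn (scoreProfile A) (Set.Ici 0) s :=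
  (isInfCompactOn_scoreProfile hA).exists_isMinOn (continuous_scoreProfile A).continuousOn
    Set.nonempty_Ici

lemma isWellPosedMin_scoreProfile (hA : A.PosDef) (hs : s ∈ Set.Ici 0)
    (hmin : IsMinOn (scoreProfile A) (Set.Ici 0) s) :
    IsWellPosedMin (scoreProfile A) (positiveOrthant ι) s :=
  ((isInfCompactOn_scoreProfile hA).isWellPosedMin (continuous_scoreProfile A).continuousOn hs
    hmin fun _ hx hx_min => ((strictConvexOn_scoreProfile hA).subset (Set.subset_univ _)
      (convex_Ici 0)).eq_of_isMinOn hx_min hmin hx hs).mono (fun _ hx i => (hx i).le)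
        (Ici_zero_subset_closure_positiveOrthant ι hs)

lemma hadamard_mulVec_apply_of_isMinOn (hA : A.IsHermitian) (hs : s ∈ Set.Ici 0)
    (hmin : IsMinOn (scoreProfile A) (Set.Ici 0) s) (hi : 0 < s i) :
    ((A ⊙ A) *ᵥ s) i = A i i := by
  classical
  have hloc : IsLocalMin (fun t : ℝ => scoreProfile A (s + t • Pi.single i 1)) 0 := by
    filter_upwards [lt_mem_nhds (neg_lt_zero.2 hi)] with t ht
    rw [zero_smul, add_zero]
    refine hmin fun j => ?_
    rcases eq_or_ne j i with rfl | hj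
    · simpa using (neg_lt_iff_pos_add'.1 ht).le
    · simpa [hj] using hs j
  simp only [scoreProfile_add_smul hA, single_one_dotProduct] at hloc
  have hderiv := hloc.hasDerivAt_eq_zero
    ((((hasDerivAt_id' (0 : ℝ)).mul_const _).const_add _).add
      (((hasDerivAt_id' (0 : ℝ)).pow 2).mul_const _))
  simpa [sub_eq_zero] using hderiv

lemma le_inv_apply_self_of_isMinOn (hA : A.PosDef) (hs : s ∈ Set.Ici 0)
    (hmin : IsMinOn (scoreProfile A) (Set.Ici 0) s) (i : ι) : s i ≤ (A i i)⁻¹ := by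
  have hAi : 0 < A i i := hA.diag_pos
  rcases (hs i).eq_or_lt with hi | hi
  · exact hi.symm.trans_le (inv_nonneg.2 hAi.le)
  · rw [← one_div, le_div_iff₀' hAi, ← mul_le_iff_le_one_right hAi, ← mul_assoc, ← sq]
    exact (sq_mul_le_hadamard_mulVec A hs i).trans_eq
      (hadamard_mulVec_apply_of_isMinOn hA.isHermitian hs hmin hi)

lemma exists_lt_inv_apply_self_of_isMinOn (hA : A.PosDef) (hdiag : ¬A.IsDiag)
    (hs : s ∈ Set.Ici 0) (hmin : IsMinOn (scoreProfile A) (Set.Ici 0) s) :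
    ∃ i, s i < (A i i)⁻¹ := by
  obtain ⟨i, j, hij, hAij⟩ : ∃ i j, i ≠ j ∧ A i j ≠ 0 := by
    simpa only [Matrix.IsDiag, Pairwise, not_forall, exists_prop] using hdiag
  rcases (hs i).eq_or_lt with hi | hi
  · exact ⟨i, hi.symm.trans_lt (inv_pos.2 hA.diag_pos)⟩
  rcases (hs j).eq_or_lt with hj | hj
  · exact ⟨j, hj.symm.trans_lt (inv_pos.2 hA.diag_pos)⟩
  refine ⟨i, ?_⟩
  have hAi : 0 < A i i := hA.diag_pos
  rw [← one_div, lt_div_iff₀' hAi, ← mul_lt_iff_lt_one_right hAi, ← mul_assoc, ← sq]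
  refine lt_of_lt_of_eq ?_ (hadamard_mulVec_apply_of_isMinOn hA.isHermitian hs hmin hi)
  rw [hadamard_self_mulVec_apply]
  exact Finset.single_lt_sum hij.symm (Finset.mem_univ i) (Finset.mem_univ j)
    (mul_pos (sq_pos_of_ne_zero hAij) hj) fun k _ _ => mul_nonneg (sq_nonneg _) (hs k)

end ScoreProfile

section Ordering

lemma isDiag_of_isDiag_inv {ι : Type*} [Fintype ι] [DecidableEq ι] {C : Matrix ι ι ℝ}
    (hC : C.PosDef) (h : C⁻¹.IsDiag) : C.IsDiag := by
  have hinv := inv_diagonal_of_mem_positiveOrthant (ψ := C⁻¹.diag) fun i => hC.inv.diag_pos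
  rw [h.diagonal_diag, Matrix.nonsing_inv_nonsing_inv _ hC.det_pos.ne'.isUnit] at hinv
  rw [hinv]
  exact Matrix.isDiag_diagonal _

lemma dominates_klReverse_scoreReverse (n : ℕ) :
    Dominates (klReverse n) (scoreReverse n) := by
  intro μ C hC hdiag
  obtain ⟨s, hs, hmin⟩ := exists_isMinOn_scoreProfile hC.inv
  obtain ⟨i, hi⟩ := exists_lt_inv_apply_self_of_isMinOn hC.inv
    (mt (isDiag_of_isDiag_inv hC) hdiag) hs hmin
  exact ⟨_, _, isOptimalVariances_klReverse_iff μ hC,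
    (isMeanProfile_scoreReverse μ hC).isOptimalVariances_iff_ofReal
      (isWellPosedMin_scoreProfile hC.inv hs hmin),
    fun j => ENNReal.ofReal_le_ofReal (le_inv_apply_self_of_isMinOn hC.inv hs hmin j),
    i, (ENNReal.ofReal_lt_ofReal_iff_of_nonneg (hs i)).2 hi⟩

lemma dominates_scoreForward_klForward (n : ℕ) :
    Dominates (scoreForward n) (klForward n) := by
  intro μ C hC hdiag
  obtain ⟨s, hs, hmin⟩ := exists_isMinOn_scoreProfile hC
  obtain ⟨i, hi⟩ := exists_lt_inv_apply_self_of_isMinOn hC hdiag hs hmin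
  have hinv (j : Fin n) : ENNReal.ofReal (C j j) = (ENNReal.ofReal (C j j)⁻¹)⁻¹ := by
    rw [ENNReal.ofReal_inv_of_pos hC.diag_pos, inv_inv]
  refine ⟨_, _, (isMeanProfile_scoreForward μ hC).isOptimalVariances_iff_inv_ofReal
    (isWellPosedMin_scoreProfile hC hs hmin), isOptimalVariances_klForward_iff μ hC,
    fun j => ?_, i, ?_⟩
  · rw [hinv, ENNReal.inv_le_inv]
    exact ENNReal.ofReal_le_ofReal (le_inv_apply_self_of_isMinOn hC hs hmin j)
  · rw [hinv, ENNReal.inv_lt_inv]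
    exact (ENNReal.ofReal_lt_ofReal_iff_of_nonneg (hs i)).2 hi

variable {α β : ℝ}

lemma dominates_renyi_klReverse (n : ℕ) (hα : α ∈ Set.Ioo (0 : ℝ) 1) :
    Dominates (renyi n α) (klReverse n) := by
  intro μ C hC hdiag
  obtain ⟨ψ, hψ, hstat, -, hopt⟩ := exists_isRenyiStationary_isMinimizer μ hC hα
  obtain ⟨i, hi⟩ := exists_one_lt_mul_inv_apply_self hC hdiag
  exact ⟨_, _, hopt, isOptimalVariances_klReverse_iff μ hC,
    fun j => ENNReal.ofReal_le_ofReal (hstat.inv_inv_apply_self_le hC hα hψ j),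
    i, (ENNReal.ofReal_lt_ofReal_iff (hψ i)).2 (hstat.inv_inv_apply_self_lt hC hα hψ hi)⟩

lemma dominates_klForward_renyi (n : ℕ) (hα : α ∈ Set.Ioo (0 : ℝ) 1) :
    Dominates (klForward n) (renyi n α) := by
  intro μ C hC hdiag
  obtain ⟨ψ, hψ, hstat, -, hopt⟩ := exists_isRenyiStationary_isMinimizer μ hC hα
  obtain ⟨i, hi⟩ := exists_one_lt_mul_inv_apply_self hC hdiag
  exact ⟨_, _, isOptimalVariances_klForward_iff μ hC, hopt,
    fun j => ENNReal.ofReal_le_ofReal (hstat.le_apply_self hC hα hψ j),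
    i, (ENNReal.ofReal_lt_ofReal_iff hC.diag_pos).2 (hstat.lt_apply_self hC hα hψ hi)⟩

lemma dominates_renyi_renyi (n : ℕ) (hα : 0 < α) (hβ : β ∈ Set.Ioo α 1) :
    Dominates (renyi n β) (renyi n α) := by
  intro μ C hC hdiag
  obtain ⟨ψ, hψ, hψ_stat, -, hψ_opt⟩ :=
    exists_isRenyiStationary_isMinimizer μ hC ⟨hα, hβ.1.trans hβ.2⟩
  obtain ⟨φ, hφ, hφ_stat, -, hφ_opt⟩ :=
    exists_isRenyiStationary_isMinimizer μ hC ⟨hα.trans hβ.1, hβ.2⟩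
  obtain ⟨i, hi⟩ := exists_one_lt_mul_inv_apply_self hC hdiag
  exact ⟨_, _, hφ_opt, hψ_opt,
    fun j => ENNReal.ofReal_le_ofReal (hψ_stat.mono hφ_stat hC hα hβ hψ hφ j),
    i, (ENNReal.ofReal_lt_ofReal_iff (hφ i)).2 (hψ_stat.strictMono hφ_stat hC hα hβ hψ hφ hi)⟩

lemma exists_isMinimizer_renyi_strictMonoOn {n : ℕ} (μ : E n) {C : Matrix (Fin n) (Fin n) ℝ}
    (hC : C.PosDef) :
    ∃ Ψ : ℝ → Fin n → ℝ,
      (∀ α ∈ Set.Ioo (0 : ℝ) 1, IsMinimizer (renyi n α) (gaussianDensity μ C) μ (Ψ α) ∧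
        ∀ v, IsOptimalVariances (renyi n α) (gaussianDensity μ C) v ↔
          v = fun i => ENNReal.ofReal (Ψ α i)) ∧
      ∀ i, 1 < C i i * C⁻¹ i i → StrictMonoOn (fun α => Ψ α i) (Set.Ioo 0 1) := by
  choose! Ψ hpos hstat hmin hopt using
    fun α (hα : α ∈ Set.Ioo (0 : ℝ) 1) => exists_isRenyiStationary_isMinimizer μ hC hα
  exact ⟨Ψ, fun α hα => ⟨hmin α hα, hopt α hα⟩, fun i hi α hα β hβ hαβ =>
    (hstat α hα).strictMono (hstat β hβ) hC hα.1 ⟨hαβ, hβ.2⟩ (hpos α hα) (hpos β hβ) hi⟩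

end Ordering

end FGVI

theorem theorem2 (n : ℕ) :
    (∀ α₁ α₂ : ℝ, 0 < α₁ → α₁ < α₂ → α₂ < 1 →
      FGVI.Dominates (FGVI.klReverse n) (FGVI.scoreReverse n) ∧
      FGVI.Dominates (FGVI.renyi n α₁) (FGVI.klReverse n) ∧
      FGVI.Dominates (FGVI.renyi n α₂) (FGVI.renyi n α₁) ∧
      FGVI.Dominates (FGVI.klForward n) (FGVI.renyi n α₂) ∧
      FGVI.Dominates (FGVI.scoreForward n) (FGVI.klForward n)) ∧
    (∀ (μ : FGVI.E n) (C : Matrix (Fin n) (Fin n) ℝ), C.PosDef → ¬ C.IsDiag →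
      ∃ Ψ : ℝ → Fin n → ℝ,
        (∀ α ∈ Set.Ioo (0 : ℝ) 1,
          (∃ ν, FGVI.IsMinimizer (FGVI.renyi n α) (FGVI.gaussianDensity μ C) ν (Ψ α)) ∧
          ∀ v, FGVI.IsOptimalVariances (FGVI.renyi n α) (FGVI.gaussianDensity μ C) v ↔
            v = fun i => ENNReal.ofReal (Ψ α i)) ∧
        ∀ i, 1 < C i i * C⁻¹ i i → StrictMonoOn (fun α => Ψ α i) (Set.Ioo 0 1)) := by
  refine ⟨fun α₁ α₂ hα₁ hlt hα₂ => ⟨FGVI.dominates_klReverse_scoreReverse n,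
    FGVI.dominates_renyi_klReverse n ⟨hα₁, hlt.trans hα₂⟩,
    FGVI.dominates_renyi_renyi n hα₁ ⟨hlt, hα₂⟩,
    FGVI.dominates_klForward_renyi n ⟨hα₁.trans hlt, hα₂⟩,
    FGVI.dominates_scoreForward_klForward n⟩, fun μ C hC _ => ?_⟩
  obtain ⟨Ψ, hΨ, hmono⟩ := FGVI.exists_isMinimizer_renyi_strictMonoOn μ hC
  exact ⟨Ψ, fun α hα => ⟨⟨μ, (hΨ α hα).1⟩, (hΨ α hα).2⟩, hmono⟩
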